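/- Let $\alpha,\varpi>0$ and consider the Hamiltonian $$H(p_r,p_z,r,z)=\frac{p_r^2+p_z^2}{2}+\frac{\varpi^2}{2r^2}-\frac1r-\frac{4\alpha^{-1}}{\sqrt{r^2+(1+2\alpha)z^2}},\qquad (p_r,p_z,r,z)\in\mathbb{R}^2\times(0,\infty)\times\mathbb{R},$$ of the spatial isosceles three-body problem, with energy surface $\mathfrak{M}=H^{-1}(-1)\subset\mathbb{R}^4$. Put $\beta=(1+4\alpha^{-1})^{-1}$ and $\epsilon=(1-2\varpi^2\beta^2)^{1/2}$, and let $\mathcal{D}=\{(\beta,\epsilon): 0<\beta^2+\epsilon^2<1,\ \beta,\epsilon>0\}$. The correspondence $(\alpha,\varpi)\leftrightarrow(\beta,\epsilon)$ is a bijection between $\{(\alpha,\varpi): \alpha,\varpi>0,\ \tfrac12<\varpi^2<\tfrac12(1+4\alpha^{-1})^2\}$ and $\mathcal{D}$. Call $\mathfrak{M}$ convex if it is the boundary of a compact convex subset of $\mathbb{R}^4$ with non-empty interior, and strictly convex if moreover it is a regular hypersurface whose second fundamental form $D^2H/|\nabla H|$ is positive definite on every tangent space. Theorem 2.11. There is a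 strictly decreasing concave function $\epsilon_{\mathrm{conv}}:[0,1]\to[0,1]$ with $\epsilon_{\mathrm{conv}}(0)=(7+\sqrt{17})/16$, $\epsilon_{\mathrm{conv}}(1)=0$ and $(\beta,\epsilon_{\mathrm{conv}}(\beta))\in\mathcal{D}$ for every $\beta\in(0,1)$, such that for every $(\beta,\epsilon)\in\mathcal{D}$ the corresponding surface $\mathfrak{M}$ satisfies - $\epsilon<\epsilon_{\mathrm{conv}}(\beta)$ if and only if $\mathfrak{M}$ is strictly convex; - $\epsilon=\epsilon_{\mathrm{conv}}(\beta)$ if and only if $\mathfrak{M}$ is convex but not strictly convex; - $\epsilon>\epsilon_{\mathrm{conv}}(\beta)$ if and only if $\mathfrak{M}$ is not convex. -/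

import Mathlib

noncomputable section

/-- The phase space `ℝ⁴`, with coordinates `(p_r, p_z, r, z) = (x 0, x 1, x 2, x 3)`. -/
abbrev PhaseSpace : Type := EuclideanSpace ℝ (Fin 4)

/-- The potential `V(r, z)` of the reduced spatial isosceles three-body problem, with mass
ratio `α` and angular momentum `ϖ`. -/
def isoPotential (α ϖ r z : ℝ) : ℝ :=
  ϖ ^ 2 / (2 * r ^ 2) - 1 / r - 4 * α⁻¹ / Real.sqrt (r ^ 2 + (1 + 2 * α) * z ^ 2)

/-- The Hamiltonian `H = (p_r² + p_z²) / 2 + V(r, z)`. It is meaningful on `isoDomain`. -/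
def isoHamiltonian (α ϖ : ℝ) (x : PhaseSpace) : ℝ :=
  ((x 0) ^ 2 + (x 1) ^ 2) / 2 + isoPotential α ϖ (x 2) (x 3)

/-- The domain `{r > 0}` of the Hamiltonian. -/
def isoDomain : Set PhaseSpace := {x | 0 < x 2}

/-- The level set `{x ∈ U | F x = c}` of a function `F` considered on `U`. -/
def levelSet {E : Type*} (F : E → ℝ) (U : Set E) (c : ℝ) : Set E := {x | x ∈ U ∧ F x = c}

/-- The energy surface `𝔐 = H⁻¹(-1)`. -/
def energySurface (α ϖ : ℝ) : Set PhaseSpace := levelSet (isoHamiltonian α ϖ) isoDomain (-1)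

/-- A closed hypersurface `S` is convex if it bounds a convex set, that is, if it is the
boundary of a compact convex set with non-empty interior. -/
def IsConvexHypersurface {E : Type*} [NormedAddCommGroup E] [NormedSpace ℝ E] (S : Set E) : Prop :=
  ∃ K : Set E, IsCompact K ∧ Convex ℝ K ∧ (interior K).Nonempty ∧ frontier K = S

/-- The second fundamental form at `x` of the level set of `F` through `x`, on vectors `v, w`
tangent to it (those killed by `fderiv ℝ F x`): `D²F(x)(v, w) / |∇F(x)|`. The sign is the one
for which round spheres, as level sets of `|x|²`, have positive second fundamental form. -/
def levelSecondFundamentalForm {E : Type*} [NormedAddCommGroup E] [InnerProductSpace ℝ E]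
    (F : E → ℝ) (x v w : E) : ℝ :=
  fderiv ℝ (fderiv ℝ F) x v w / ‖fderiv ℝ F x‖

/-- A regular level hypersurface `{x ∈ U | F x = c}` is strictly convex if it bounds a convex
set and its second fundamental form is positive definite at every point (equivalently, it
bounds a convex set and has positive curvature everywhere). -/
def IsStrictlyConvexLevel {E : Type*} [NormedAddCommGroup E] [InnerProductSpace ℝ E]
    (F : E → ℝ) (U : Set E) (c : ℝ) : Prop :=
  IsConvexHypersurface (levelSet F U c) ∧
    ∀ x ∈ levelSet F U c, fderiv ℝ F x ≠ 0 ∧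
      ∀ v : E, v ≠ 0 → fderiv ℝ F x v = 0 → 0 < levelSecondFundamentalForm F x v v

/-- The energy surface bounds a convex subset of `ℝ⁴`. -/
def EnergySurfaceConvex (α ϖ : ℝ) : Prop := IsConvexHypersurface (energySurface α ϖ)

/-- The energy surface is strictly convex. -/
def EnergySurfaceStrictlyConvex (α ϖ : ℝ) : Prop :=
  IsStrictlyConvexLevel (isoHamiltonian α ϖ) isoDomain (-1)

/-- The parameter `β = (1 + 4 α⁻¹)⁻¹`. -/
def betaParam (α : ℝ) : ℝ := (1 + 4 * α⁻¹)⁻¹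

/-- The parameter `ε = (1 - 2 ϖ² β²)^(1/2)`. When the radicand is negative (and the energy
surface is empty) its value here is `0`, which is excluded by `paramDomain`. -/
def epsParam (α ϖ : ℝ) : ℝ := Real.sqrt (1 - 2 * ϖ ^ 2 * betaParam α ^ 2)

/-- The parameter domain `𝒟 = {(β, ε) : 0 < β² + ε² < 1, β, ε > 0}`. -/
def paramDomain : Set (ℝ × ℝ) :=
  {q | 0 < q.1 ^ 2 + q.2 ^ 2 ∧ q.1 ^ 2 + q.2 ^ 2 < 1 ∧ 0 < q.1 ∧ 0 < q.2}

end

open Filter Topology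

noncomputable section

/-! In rescaled coordinates the energy surface is |p|²/2 = U(r, z), where U is `hillFn` and c = 1 -
ε² (`angParam`). Put h = r/√(r² + z²), q = β + (1 - β)h and y = 1/r; then U = -1 - c y² + 2 q y. A
direction of the (r, z)-plane lifts to tangent vectors (a, ·) with p·a = dU, and by Cauchy–Schwarz
the least |a|² is dU²/(2U). So over {U > 0} positive curvature means that 2U D²U - dU ⊗ dU is
negative definite. Its determinant is, up to positive factors, `detCoeff`.

At fixed h put λ = 1 - c/q² and τ = 1 - c y/q. The Hill region is τ² ≤ λ and the determinant becomes
a cubic in τ (`mul_detCoeff_eq`) whose coefficients depend on h and β only through one ratio. That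
ratio is parametrised by a so that the critical λ is rational in a: at λ = `critLambda a` the cubic
has a double root `critTau a` (`critForm_critLambda`). Hence the form stays definite at height h
exactly when √c exceeds q Φ(a), with Φ = `critFactor`. The threshold for √c is the supremum
`critBound β` of these values over all h, and ε_conv = √(1 - `critBound`²). The two halves of this
claim are `coeffs_of_critBound_sq_lt` and `exists_degenerate_point`.

Concavity of ε_conv follows from convexity of `critBound`, which has a supporting line everywhere
(`exists_affine_le_critBound`). Where h² < 2/3 the height is held fixed and Φ, as a function of the
ratio, lies above its tangents. Where h² > 2/3 the parameter a is held fixed, and a concave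
homogeneous relation between 1 - β, (1 - β)h and q lies below its tangent planes. At β = 0 the
maximisation is explicit, with maximiser a = (3 - √17)/2. The supporting line there has positive
slope, and concavity then makes ε_conv strictly decreasing.

Geometrically, a connected sublevel set with positively curved boundary is convex
(`convex_sublevel_of_pos_curvature`). The threshold case is reached by letting ϖ decrease to its
critical value. Beyond the threshold a tangent vector with D²H < 0 excludes convexity
(`nonneg_of_mem_frontier`). -/

/-! ### Polynomial inequalities -/

/-- The quadratic `3a² - 4a + 12`. -/
def critTheta (a : ℝ) : ℝ := 3 * a ^ 2 - 4 * a + 12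

/-- The quadratic `a² - 2a + 8`. -/
def critDen (a : ℝ) : ℝ := a ^ 2 - 2 * a + 8

lemma critTheta_pos (a : ℝ) : 0 < critTheta a := by
  unfold critTheta; nlinarith [sq_nonneg (3 * a - 2)]

lemma critDen_pos (a : ℝ) : 0 < critDen a := by
  unfold critDen; nlinarith [sq_nonneg (a - 1)]

/-- The factor by which `√c` is proportional to `q` at the degenerate point with parameter `a`. -/
def critFactor (a : ℝ) : ℝ := 2 * √(critTheta a) / critDen a

lemma critFactor_pos (a : ℝ) : 0 < critFactor a := by
  have := Real.sqrt_pos.2 (critTheta_pos a)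
  have := critDen_pos a
  unfold critFactor; positivity

lemma critFactor_sq (a : ℝ) : critFactor a ^ 2 = 4 * critTheta a / critDen a ^ 2 := by
  unfold critFactor
  rw [div_pow, mul_pow, Real.sq_sqrt (critTheta_pos a).le]; norm_num

/-- The parameter `λ = 1 - c / q²` at the degenerate point. -/
def critLambda (a : ℝ) : ℝ := (a - 2) ^ 2 * (a ^ 2 + 4) / critDen a ^ 2

lemma one_sub_critLambda (a : ℝ) : 1 - critLambda a = critFactor a ^ 2 := by
  have := (critDen_pos a).ne'
  rw [critFactor_sq, critLambda, eq_div_iff (by positivity), sub_mul, div_mul_cancel₀ _ (by positivity)]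
  unfold critDen critTheta; ring

lemma critLambda_nonneg (a : ℝ) : 0 ≤ critLambda a := by
  unfold critLambda; positivity

lemma critFactor_le_one (a : ℝ) : critFactor a ≤ 1 := by
  have h1 := one_sub_critLambda a
  have h2 := critLambda_nonneg a
  nlinarith [critFactor_pos a]

/-- This is `critFactor_tangent` with the denominators cleared; equality holds at a = b. -/
lemma critFactor_tangent_aux {a b : ℝ} (ha : 0 ≤ a) (ha2 : a ≤ 2) (hb : 0 ≤ b) (hb2 : b ≤ 2) :
    3 * a ^ 3 - 6 * a ^ 2 + 24 * a + b ^ 2 * (3 * a - 2) ≤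
      2 * a * (√(critTheta a) * √(critTheta b)) := by
  rw [← Real.sqrt_mul (critTheta_pos a).le]
  rcases le_total a (2 / 3) with h | h
  -- Cauchy–Schwarz for the quadratic form with values `critTheta`: the left side is its
  -- polarisation at (a, 1) and (b, 1).
  · have h1 : 3 * a * b - 2 * a - 2 * b + 12 ≤ √(critTheta a * critTheta b) := by
      apply Real.le_sqrt_of_sq_le
      unfold critTheta
      nlinarith [sq_nonneg (a - b)]
    have h2 : 0 ≤ (2 - 3 * a) * (a - b) ^ 2 := mul_nonneg (by linarith) (sq_nonneg _)
    nlinarith [mul_le_mul_of_nonneg_left h1 (by linarith : 0 ≤ 2 * a)]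
  · have h1 : 2 * a * √(critTheta a * critTheta b) =
        √((2 * a) ^ 2 * (critTheta a * critTheta b)) := by
      rw [Real.sqrt_mul (sq_nonneg (2 * a)), Real.sqrt_sq (by linarith)]
    rw [h1]
    apply Real.le_sqrt_of_sq_le
    -- For a ≥ 2/3 the difference of squares contains (b - a)², and b ≤ 2 bounds the cofactor below
    -- by a polynomial in a alone.
    have h2 : (2 * a) ^ 2 * (critTheta a * critTheta b) -
        (3 * a ^ 3 - 6 * a ^ 2 + 24 * a + b ^ 2 * (3 * a - 2)) ^ 2 =
        (b - a) ^ 2 * (-((3 * a - 2) ^ 2 * (b ^ 2 + 2 * a * b) +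
          3 * a * (3 * a ^ 3 - 12 * a ^ 2 + 12 * a - 32))) := by
      unfold critTheta; ring
    have h3 : (3 * a - 2) ^ 2 * (b ^ 2 + 2 * a * b) ≤ (3 * a - 2) ^ 2 * (4 + 4 * a) := by
      apply mul_le_mul_of_nonneg_left _ (sq_nonneg _)
      nlinarith
    have h4 : 9 * a ^ 4 + 24 * a ^ 2 - 128 * a + 16 ≤ 0 := by
      have : 0 ≤ (2 - a) * (a - 2 / 3) := mul_nonneg (by linarith) (by linarith)
      nlinarith [mul_nonneg this (sq_nonneg a), mul_nonneg this ha]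
    have h5 : 0 ≤ (b - a) ^ 2 * (-((3 * a - 2) ^ 2 * (b ^ 2 + 2 * a * b) +
          3 * a * (3 * a ^ 3 - 12 * a ^ 2 + 12 * a - 32))) :=
      mul_nonneg (sq_nonneg _) (by nlinarith)
    linarith

/-- The form that decides the sign of the curvature, at `λ = 1 - c / q²` and `τ = 1 - c y / q`. -/
def critForm (a l t : ℝ) : ℝ :=
  (2 - a) ^ 2 * (2 + a) * (1 - 4 * l + 3 * t ^ 2) -
    2 * a * critDen a * (l - 3 * l * t + 2 * t ^ 3)

/-- The double root of `critForm a (critLambda a)`. -/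
def critTau (a : ℝ) : ℝ := a * (a - 2) / critDen a

/-- The double root is what makes `critLambda a` the threshold: there the cubic touches zero. The
remaining factor is nonnegative for t² ≤ `critLambda a`, as shown inside `critForm_pos`. -/
lemma critForm_critLambda (a t : ℝ) :
    critForm a (critLambda a) t =
      (t - critTau a) ^ 2 * ((2 - a) * (5 * a ^ 2 + 12) - 4 * a * critDen a * t) := by
  have := (critDen_pos a).ne'
  unfold critForm critLambda critTau
  field_simp
  unfold critDen
  ring

/-- Evaluating at the double root turns the sign of the form into the comparison of l with the
critical value; this produces the degenerate and negative directions. -/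
lemma critForm_critTau (a l : ℝ) : critForm a l (critTau a) = 32 * (critLambda a - l) := by
  have := (critDen_pos a).ne'
  unfold critForm critLambda critTau
  field_simp
  unfold critDen
  ring

lemma critForm_sub (a l l' t : ℝ) :
    critForm a l t - critForm a l' t =
      (l' - l) * (4 * (2 - a) ^ 2 * (2 + a) + 2 * a * critDen a * (1 - 3 * t)) := by
  unfold critForm; ring

/-- The form is affine in l and nonnegative at l = `critLambda a`. If it decreases in l, positivity
below follows. Otherwise a < 0, and l is compared with the lower end t², where the form factors with
visibly positive factors. -/
lemma critForm_pos {a l t : ℝ} (ha : -2 < a) (ha2 : a ≤ 2) (ht : t ^ 2 ≤ l)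
    (hl : l < critLambda a) : 0 < critForm a l t := by
  have hw := critDen_pos a
  have hs : 0 ≤ √(a ^ 2 + 4) := Real.sqrt_nonneg _
  have hs2 : √(a ^ 2 + 4) ^ 2 = a ^ 2 + 4 := Real.sq_sqrt (by positivity)
  have htw : |critDen a * t| ≤ (2 - a) * √(a ^ 2 + 4) := by
    apply abs_le_of_sq_le_sq _ (mul_nonneg (by linarith) hs)
    have h1 : t ^ 2 * critDen a ^ 2 ≤ (a - 2) ^ 2 * (a ^ 2 + 4) := by
      have : t ^ 2 ≤ (a - 2) ^ 2 * (a ^ 2 + 4) / critDen a ^ 2 := ht.trans hl.le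
      rwa [le_div_iff₀ (by positivity)] at this
    rw [mul_pow, mul_pow, hs2]
    nlinarith
  have hmain : 0 ≤ critForm a (critLambda a) t := by
    rw [critForm_critLambda]
    apply mul_nonneg (sq_nonneg _)
    have h1 : 4 * |a| * √(a ^ 2 + 4) ≤ 5 * a ^ 2 + 12 := by
      have := sq_abs a
      nlinarith [sq_nonneg (2 * |a| - √(a ^ 2 + 4))]
    have h2 : 4 * (a * (critDen a * t)) ≤ (2 - a) * (5 * a ^ 2 + 12) := by
      calc 4 * (a * (critDen a * t)) ≤ 4 * (|a| * |critDen a * t|) := by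
            rw [← abs_mul]; linarith [le_abs_self (a * (critDen a * t))]
        _ ≤ 4 * (|a| * ((2 - a) * √(a ^ 2 + 4))) := by gcongr
        _ = (2 - a) * (4 * |a| * √(a ^ 2 + 4)) := by ring
        _ ≤ _ := mul_le_mul_of_nonneg_left h1 (by linarith)
    linarith
  have hsub := critForm_sub a l (critLambda a) t
  rcases lt_or_ge 0 (4 * (2 - a) ^ 2 * (2 + a) + 2 * a * critDen a * (1 - 3 * t)) with hc | hc
  · have := mul_pos (sub_pos.2 hl) hc
    linarith
  · have ha0 : a < 0 := by
      by_contra! ha0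
      have h1 : critDen a * t ≤ (2 - a) * (a + 2) := by
        refine (le_abs_self _).trans (htw.trans ?_)
        apply mul_le_mul_of_nonneg_left _ (by linarith)
        rw [Real.sqrt_le_left (by linarith)]
        nlinarith
      have h2 : 0 < 12 * a ^ 3 - 12 * a ^ 2 - 24 * a + 32 := by
        nlinarith [mul_nonneg ha0 (sq_nonneg (a - 6/5))]
      have h3 : 2 * a * critDen a = 2 * a ^ 3 - 4 * a ^ 2 + 16 * a := by unfold critDen; ring
      have h4 := mul_le_mul_of_nonneg_left h1 ha0
      nlinarith
    have h1 : critForm a l t - critForm a (t ^ 2) t =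
      (t ^ 2 - l) * (4 * (2 - a) ^ 2 * (2 + a) + 2 * a * critDen a * (1 - 3 * t)) :=
      critForm_sub a l (t ^ 2) t
    have h2 : 0 ≤ (t ^ 2 - l) *
        (4 * (2 - a) ^ 2 * (2 + a) + 2 * a * critDen a * (1 - 3 * t)) :=
      mul_nonneg_of_nonpos_of_nonpos (by linarith) hc
    have h3 : critForm a (t ^ 2) t =
        (1 - t) * ((2 - a) ^ 2 * (2 + a) * (1 + t) + 2 * (-a) * critDen a * t ^ 2) := by
      unfold critForm; ring
    have h5 : t ^ 2 < 1 := by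
      have := one_sub_critLambda a
      have := pow_pos (critFactor_pos a) 2
      linarith
    have h6 : -1 < t ∧ t < 1 := by constructor <;> nlinarith
    have h7 : 0 < critForm a (t ^ 2) t := by
      rw [h3]
      apply mul_pos (by linarith)
      have h8 : 0 < (2 - a) ^ 2 * (2 + a) * (1 + t) :=
        mul_pos (mul_pos (by nlinarith) (by linarith)) (by linarith)
      have : 0 < -a := by linarith
      positivity
    linarith

/-- Ensures U > 0 at the degenerate point, because (c/q²) U = λ - τ². -/
lemma critTau_sq_lt {a : ℝ} (ha2 : a < 2) : critTau a ^ 2 < critLambda a := by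
  unfold critTau critLambda
  rw [div_pow]
  have := critDen_pos a
  gcongr
  nlinarith [sq_pos_of_pos (sub_pos.2 ha2)]

/-! ### The threshold function -/

/-- Pairs `(h, a)` such that the parameter `a` describes the degenerate point at height `h`. -/
def critSet (β : ℝ) : Set (ℝ × ℝ) :=
  {p | (p.1 ∈ Set.Icc (0 : ℝ) 1 ∧ p.2 ∈ Set.Icc (-2 : ℝ) 2) ∧
    (1 - β) * p.1 * (1 - p.1 ^ 2) * (2 * p.2 * critDen p.2) =
      (β + (1 - β) * p.1) * (2 - 3 * p.1 ^ 2) * ((2 - p.2) ^ 2 * (2 + p.2)) ∧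
    0 ≤ (2 - 3 * p.1 ^ 2) * p.2}

/-- The value of `√c` at which the point `(h, a)` becomes degenerate. -/
def critValue (β : ℝ) (p : ℝ × ℝ) : ℝ := (β + (1 - β) * p.1) * critFactor p.2

/-- The threshold for `√c = √(1 - ε²)`. -/
def critBound (β : ℝ) : ℝ := sSup (critValue β '' critSet β)

lemma continuous_critDen : Continuous critDen := by unfold critDen; fun_prop

lemma continuous_critFactor : Continuous critFactor := by
  unfold critFactor critTheta
  exact Continuous.div (by fun_prop) continuous_critDen fun a => (critDen_pos a).ne'

lemma continuous_critValue (β : ℝ) : Continuous (critValue β) := by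
  unfold critValue
  exact Continuous.mul (by fun_prop) (continuous_critFactor.comp continuous_snd)

/-- The relation is cross-multiplied, so it is a closed condition even where a quotient would be
undefined, and the supremum in `critBound` is attained. The sign condition selects the right root:
at h = 1 the relation leaves a = ±2, and only a = -2 survives. -/
lemma isCompact_critSet (β : ℝ) : IsCompact (critSet β) := by
  have h1 : IsCompact (Set.Icc (0 : ℝ) 1 ×ˢ Set.Icc (-2 : ℝ) 2) := isCompact_Icc.prod isCompact_Icc
  have hd : Continuous fun p : ℝ × ℝ => critDen p.2 := continuous_critDen.comp continuous_snd
  have h2 : IsClosed {p : ℝ × ℝ | (1 - β) * p.1 * (1 - p.1 ^ 2) * (2 * p.2 * critDen p.2) =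
      (β + (1 - β) * p.1) * (2 - 3 * p.1 ^ 2) * ((2 - p.2) ^ 2 * (2 + p.2))} :=
    isClosed_eq (by fun_prop) (by fun_prop)
  have h3 : IsClosed {p : ℝ × ℝ | 0 ≤ (2 - 3 * p.1 ^ 2) * p.2} :=
    isClosed_le (by fun_prop) (by fun_prop)
  exact h1.inter_right (h2.inter h3)

/-- The point on the plane z = 0. It contributes √(1/2), hence `critBound`² ≥ 1/2, which is what
negativity of the radial coefficient needs in `cubic_pos`. -/
lemma one_neg_two_mem_critSet (β : ℝ) : ((1 : ℝ), (-2 : ℝ)) ∈ critSet β := by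
  simp only [critSet, Set.mem_ofPred_eq, Set.mem_Icc]
  norm_num

lemma le_critBound {β : ℝ} {p : ℝ × ℝ} (hp : p ∈ critSet β) : critValue β p ≤ critBound β :=
  le_csSup ((isCompact_critSet β).image (continuous_critValue β)).bddAbove
    (Set.mem_image_of_mem _ hp)

lemma exists_eq_critBound (β : ℝ) : ∃ h a, (h, a) ∈ critSet β ∧
    critBound β = (β + (1 - β) * h) * critFactor a := by
  obtain ⟨⟨h, a⟩, hp, he⟩ := ((isCompact_critSet β).image (continuous_critValue β)).sSup_mem
    ⟨_, Set.mem_image_of_mem _ (one_neg_two_mem_critSet β)⟩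
  exact ⟨h, a, hp, he.symm⟩

lemma critFactor_neg_two : critFactor (-2) = √(1 / 2) := by
  symm
  rw [Real.sqrt_eq_iff_mul_self_eq (by norm_num) (critFactor_pos _).le, ← sq, critFactor_sq]
  norm_num [critTheta, critDen]

lemma sqrt_half_le_critBound (β : ℝ) : √(1 / 2) ≤ critBound β := by
  have := le_critBound (one_neg_two_mem_critSet β)
  simpa [critValue, critFactor_neg_two] using this

lemma critBound_pos (β : ℝ) : 0 < critBound β :=
  lt_of_lt_of_le (by positivity) (sqrt_half_le_critBound β)

lemma half_le_critBound_sq (β : ℝ) : 1 / 2 ≤ critBound β ^ 2 :=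
  Real.sqrt_le_left (critBound_pos β).le |>.1 (sqrt_half_le_critBound β)

section

variable {β : ℝ}

lemma height_nonneg (h0 : 0 ≤ β) (h1 : β ≤ 1) {h : ℝ} (hh : 0 ≤ h) : 0 ≤ β + (1 - β) * h :=
  add_nonneg h0 (mul_nonneg (by linarith) hh)

lemma height_pos (h0 : 0 ≤ β) (h1 : β ≤ 1) {h : ℝ} (hh : 0 < h) : 0 < β + (1 - β) * h := by
  rcases h0.eq_or_lt with rfl | h0
  · simpa using hh
  · exact add_pos_of_pos_of_nonneg h0 (mul_nonneg (by linarith) hh.le)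

lemma height_le_one (h1 : β ≤ 1) {h : ℝ} (hh : h ≤ 1) : β + (1 - β) * h ≤ 1 := by
  nlinarith

lemma critBound_le_one (h1 : β ≤ 1) : critBound β ≤ 1 := by
  obtain ⟨h, a, ⟨⟨⟨hh0, hh1⟩, -⟩, -⟩, he⟩ := exists_eq_critBound β
  rw [he]
  exact mul_le_one₀ (height_le_one h1 hh1) (critFactor_pos a).le (critFactor_le_one a)

lemma critBound_lt_one (h1 : β < 1) : critBound β < 1 := by
  obtain ⟨h, a, ⟨⟨⟨hh0, hh1⟩, ⟨ha1, ha2⟩⟩, hr, hs⟩, he⟩ := exists_eq_critBound β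
  simp only at hh0 hh1 ha1 ha2 hr hs
  rw [he]
  rcases hh1.lt_or_eq with hh1 | rfl
  · have hq : β + (1 - β) * h < 1 := by nlinarith
    nlinarith [critFactor_pos a, critFactor_le_one a]
  · have h2 : (2 - a) ^ 2 * (2 + a) = 0 := by linarith
    have h3 : a = -2 := by
      rcases mul_eq_zero.1 h2 with h3 | h3
      · have := pow_eq_zero_iff (two_ne_zero) |>.1 h3
        linarith
      · linarith
    rw [h3, critFactor_neg_two]
    have : √(1 / 2 : ℝ) < 1 := by rw [Real.sqrt_lt' one_pos]; norm_num
    linarith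

/-- At every height there is a degenerate point. -/
lemma exists_mem_critSet (h0 : 0 ≤ β) (h1 : β ≤ 1) {h : ℝ} (hh0 : 0 ≤ h) (hh1 : h ≤ 1) :
    ∃ a, (h, a) ∈ critSet β := by
  have hq := height_nonneg h0 h1 hh0
  have hm : 0 ≤ (1 - β) * h * (1 - h ^ 2) :=
    mul_nonneg (mul_nonneg (by linarith) hh0) (by nlinarith)
  have hc : Continuous fun a => (1 - β) * h * (1 - h ^ 2) * (2 * a * critDen a) -
      (β + (1 - β) * h) * (2 - 3 * h ^ 2) * ((2 - a) ^ 2 * (2 + a)) := by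
    have := continuous_critDen
    fun_prop
  rcases le_total 0 (2 - 3 * h ^ 2) with hk | hk
  · obtain ⟨a, ha, he⟩ := intermediate_value_Icc (by norm_num : (0 : ℝ) ≤ 2) hc.continuousOn
      (show (0 : ℝ) ∈ _ by
        constructor
        · nlinarith [mul_nonneg hq hk]
        · norm_num [critDen]; linarith)
    exact ⟨a, ⟨⟨hh0, hh1⟩, by linarith [ha.1], ha.2⟩, sub_eq_zero.1 he, mul_nonneg hk ha.1⟩
  · obtain ⟨a, ha, he⟩ := intermediate_value_Icc (by norm_num : (-2 : ℝ) ≤ 0) hc.continuousOn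
      (show (0 : ℝ) ∈ _ by
        constructor
        · norm_num [critDen]; linarith
        · nlinarith [mul_nonneg hq (neg_nonneg.2 hk)])
    exact ⟨a, ⟨⟨hh0, hh1⟩, ha.1, by linarith [ha.2]⟩, sub_eq_zero.1 he,
      mul_nonneg_of_nonpos_of_nonpos hk ha.2⟩

/-- Intermediate value theorem in h between √(2/3) and 1. It allows a to be kept fixed while β
varies. -/
lemma exists_height_mem_critSet (h1 : β ≤ 1) {a : ℝ} (ha : -2 ≤ a) (ha0 : a ≤ 0) :
    ∃ h, 2 / 3 ≤ h ^ 2 ∧ (h, a) ∈ critSet β := by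
  have hc : Continuous fun h => (1 - β) * h * (1 - h ^ 2) * (2 * a * critDen a) -
      (β + (1 - β) * h) * (2 - 3 * h ^ 2) * ((2 - a) ^ 2 * (2 + a)) := by
    fun_prop
  have hs : √(2 / 3 : ℝ) ≤ 1 := by rw [Real.sqrt_le_left one_pos.le]; norm_num
  have hs2 : √(2 / 3 : ℝ) ^ 2 = 2 / 3 := Real.sq_sqrt (by norm_num)
  have hs0 : 0 ≤ √(2 / 3 : ℝ) := Real.sqrt_nonneg _
  have hN : 0 ≤ (2 - a) ^ 2 * (2 + a) := mul_nonneg (sq_nonneg _) (by linarith)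
  have hw := critDen_pos a
  obtain ⟨h, hh, he⟩ := intermediate_value_Icc hs hc.continuousOn
      (show (0 : ℝ) ∈ _ by
        constructor
        · rw [hs2]
          have : 0 ≤ (1 - β) * √(2 / 3 : ℝ) * critDen a * (-a) :=
            mul_nonneg (mul_nonneg (mul_nonneg (by linarith) hs0) hw.le) (by linarith)
          linarith
        · linarith)
  have hh2 : 2 / 3 ≤ h ^ 2 := by
    rw [← hs2]; exact pow_le_pow_left₀ hs0 hh.1 2
  exact ⟨h, hh2, ⟨⟨hs0.trans hh.1, hh.2⟩, ha, by linarith⟩, sub_eq_zero.1 he,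
      mul_nonneg_of_nonpos_of_nonpos (by linarith) ha0⟩

/-- The two sides of the relation that defines `critSet` are positive multiples of the
coefficients of `critForm`. -/
lemma exists_scale_of_mem_critSet (h0 : 0 ≤ β) (h1 : β < 1) {h a : ℝ} (hp : (h, a) ∈ critSet β)
    (hh : 0 < h) : ∃ ρ, 0 < ρ ∧ (1 - β) * h * (1 - h ^ 2) = ρ * ((2 - a) ^ 2 * (2 + a)) ∧
      (β + (1 - β) * h) * (2 - 3 * h ^ 2) = ρ * (2 * a * critDen a) := by
  obtain ⟨⟨⟨-, hh1⟩, ⟨ha1, ha2⟩⟩, hr, hs⟩ := hp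
  simp only at hh1 ha1 ha2 hr hs
  have hq := height_pos h0 h1.le hh
  have hw := critDen_pos a
  have hm : 0 < (1 - β) * h := mul_pos (by linarith) hh
  rcases hh1.eq_or_lt with rfl | hh1
  · have h2 : (2 - a) ^ 2 * (2 + a) = 0 := by linarith
    have h3 : a = -2 := by
      rcases mul_eq_zero.1 h2 with h3 | h3
      · have := pow_eq_zero_iff (two_ne_zero) |>.1 h3
        linarith
      · linarith
    subst h3
    refine ⟨1 / 64, by norm_num, by norm_num, by norm_num [critDen]⟩
  · have hX : 0 < (1 - β) * h * (1 - h ^ 2) := mul_pos hm (by nlinarith)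
    have hN : 0 < (2 - a) ^ 2 * (2 + a) := by
      have h2 : a ≠ 2 := by
        rintro rfl
        have : 0 < (1 - β) * h * (1 - h ^ 2) * (2 * 2 * critDen 2) := by positivity
        rw [sub_self, zero_pow two_ne_zero, zero_mul, mul_zero] at hr; linarith
      have h3 : a ≠ -2 := by
        rintro rfl
        have : 0 < (1 - β) * h * (1 - h ^ 2) * (2 * 2 * critDen (-2)) := by positivity
        rw [add_neg_cancel, mul_zero, mul_zero] at hr; linarith
      have h4 : 0 < 2 - a := by
        have := lt_of_le_of_ne ha2 h2; linarith
      have h5 : 0 < 2 + a := by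
        have := lt_of_le_of_ne ha1 (Ne.symm h3); linarith
      positivity
    refine ⟨(1 - β) * h * (1 - h ^ 2) / ((2 - a) ^ 2 * (2 + a)), by positivity,
      (div_mul_cancel₀ _ hN.ne').symm, ?_⟩
    rw [div_mul_eq_mul_div, eq_div_iff hN.ne', ← hr]

end

/-! ### Supporting lines of the threshold function -/

/-- As a function of X = (2 - a)²(2 + a)/(a `critDen a`), Φ lies above its tangent line at the
parameter b. Since qX = 2(1 - β)h(1 - h²)/(2 - 3h²) is affine in β at fixed h, this yields bounds
for qΦ affine in β. -/
lemma critFactor_tangent {a b : ℝ} (ha : 0 < a) (ha2 : a ≤ 2) (hb : 0 ≤ b) (hb2 : b ≤ 2) :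
    ((b ^ 2 + 12) - b ^ 2 * ((2 - a) ^ 2 * (2 + a)) / (a * critDen a)) / (4 * √(critTheta b)) ≤
      critFactor a := by
  have hw := critDen_pos a
  have hb' := Real.sqrt_pos.2 (critTheta_pos b)
  have := critFactor_tangent_aux ha.le ha2 hb hb2
  unfold critFactor
  rw [div_le_div_iff₀ (by positivity) hw, sub_mul, div_mul_eq_mul_div,
    mul_div_mul_right _ _ hw.ne', sub_le_iff_le_add, ← sub_le_iff_le_add', le_div_iff₀ ha]
  have h2 : (b ^ 2 + 12) * critDen a * a - b ^ 2 * ((2 - a) ^ 2 * (2 + a)) =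
    4 * (3 * a ^ 3 - 6 * a ^ 2 + 24 * a + b ^ 2 * (3 * a - 2)) := by
    unfold critDen; ring
  linarith

lemma critFactor_tangent_self {b : ℝ} (hb : 0 < b) :
    ((b ^ 2 + 12) - b ^ 2 * ((2 - b) ^ 2 * (2 + b)) / (b * critDen b)) / (4 * √(critTheta b)) =
      critFactor b := by
  have hw := critDen_pos b
  have hb' := Real.sqrt_pos.2 (critTheta_pos b)
  have hs := Real.sq_sqrt (critTheta_pos b).le
  unfold critFactor
  rw [div_eq_div_iff (by positivity) hw.ne', sub_mul, div_mul_eq_mul_div,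
    mul_div_mul_right _ _ hw.ne', sub_eq_iff_eq_add, ← sub_eq_iff_eq_add', eq_div_iff hb.ne']
  have h3 : 2 * √(critTheta b) * (4 * √(critTheta b)) = 8 * critTheta b := by
    linear_combination 8 * hs
  rw [h3]
  unfold critDen critTheta; ring

/-- For `h² < 2/3` the degenerate points satisfy an inequality that is affine in `β`. -/
lemma affine_le_critBound_of_sq_lt {β : ℝ} (h0 : 0 ≤ β) (h1 : β ≤ 1) {h b : ℝ} (hh0 : 0 < h)
    (hk : 0 < 2 - 3 * h ^ 2) (hb : 0 ≤ b) (hb2 : b ≤ 2) :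
    ((b ^ 2 + 12) * (β + (1 - β) * h) -
      2 * b ^ 2 * ((1 - β) * h * (1 - h ^ 2) / (2 - 3 * h ^ 2))) / (4 * √(critTheta b)) ≤
      critBound β := by
  have hh1 : h ≤ 1 := by nlinarith
  obtain ⟨a, ha⟩ := exists_mem_critSet h0 h1 hh0.le hh1
  refine le_trans ?_ (le_critBound ha)
  obtain ⟨⟨-, -, ha2⟩, hr, hs⟩ := ha
  simp only at ha2 hr hs
  have hq := height_pos h0 h1 hh0
  have ha0 : 0 < a := by
    refine lt_of_le_of_ne (nonneg_of_mul_nonneg_right hs hk) ?_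
    rintro rfl
    have := mul_pos hq hk
    linarith
  have hw := critDen_pos a
  have h2 : (1 - β) * h * (1 - h ^ 2) / (2 - 3 * h ^ 2) =
      (β + (1 - β) * h) * ((2 - a) ^ 2 * (2 + a)) / (2 * a * critDen a) := by
    rw [div_eq_div_iff hk.ne' (by positivity), hr]; ring
  have h3 := mul_le_mul_of_nonneg_left (critFactor_tangent ha0 ha2 hb hb2) hq.le
  refine le_trans (le_of_eq ?_) h3
  rw [h2]
  field_simp

/-- Any small height gives a strict gain over the value β at h = 0; the sample h = 1/2, b = 2
already gives β + 0.35(1 - β). -/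
lemma lt_critBound {β : ℝ} (h0 : 0 ≤ β) (h1 : β < 1) : β < critBound β := by
  refine lt_of_lt_of_le ?_ (affine_le_critBound_of_sq_lt h0 h1.le (h := 1 / 2) (b := 2)
    (by norm_num) (by norm_num) (by norm_num) (by norm_num))
  have : √(critTheta 2) = 4 := by
    rw [Real.sqrt_eq_iff_mul_self_eq (critTheta_pos _).le (by norm_num)]
    norm_num [critTheta]
  rw [this]
  norm_num
  linarith

lemma self_le_critBound (β : ℝ) : β ≤ critBound β := by
  have h2 : ((0 : ℝ), (2 : ℝ)) ∈ critSet β := by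
    simp only [critSet, Set.mem_ofPred_eq, Set.mem_Icc]
    norm_num
  have h3 : critFactor 2 = 1 := by
    have : critFactor 2 ^ 2 = 1 := by rw [critFactor_sq]; norm_num [critTheta, critDen]
    nlinarith [critFactor_pos 2]
  have := le_critBound h2
  simpa [critValue, h3] using this

lemma critBound_one : critBound 1 = 1 :=
  le_antisymm (critBound_le_one le_rfl) (self_le_critBound 1)

lemma height_pos_of_eq_critBound {β h a : ℝ} (h0 : 0 ≤ β) (h1 : β < 1) (hh : 0 ≤ h)
    (he : critBound β = (β + (1 - β) * h) * critFactor a) : 0 < h := by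
  refine lt_of_le_of_ne hh ?_
  rintro rfl
  have := lt_critBound h0 h1
  have := critFactor_le_one a
  nlinarith

/-- The concave homogeneous function `m √((m + 3 G q) / (m + 2 G q))` lies below its tangents. -/
lemma tangent_of_homogeneous {G m q n m₀ q₀ n₀ : ℝ} (hG : 0 ≤ G) (hm : 0 < m) (hq : 0 ≤ q)
    (hm₀ : 0 < m₀) (hq₀ : 0 ≤ q₀) (hn₀ : 0 < n₀)
    (he : n ^ 2 * (m + 2 * G * q) = m ^ 2 * (m + 3 * G * q))
    (he₀ : n₀ ^ 2 * (m₀ + 2 * G * q₀) = m₀ ^ 2 * (m₀ + 3 * G * q₀)) :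
    n ≤ n₀ * (1 / m₀ - G * q₀ / (2 * (m₀ + 3 * G * q₀) * (m₀ + 2 * G * q₀))) * m +
      n₀ * (G * m₀ / (2 * (m₀ + 3 * G * q₀) * (m₀ + 2 * G * q₀))) * q := by
  have hGq : 0 ≤ G * q := mul_nonneg hG hq
  have hGq₀ : 0 ≤ G * q₀ := mul_nonneg hG hq₀
  set E := m + 2 * G * q with hE
  set N := m + 3 * G * q with hN
  set E₀ := m₀ + 2 * G * q₀ with hE₀
  set N₀ := m₀ + 3 * G * q₀ with hN₀
  have pE : 0 < E := by rw [hE]; linarith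
  have pE₀ : 0 < E₀ := by rw [hE₀]; linarith
  have pN₀ : 0 < N₀ := by rw [hN₀]; linarith
  have hpos : 0 ≤ 1 / m₀ - G * q₀ / (2 * N₀ * E₀) := by
    rw [sub_nonneg, div_le_div_iff₀ (by positivity) hm₀]
    nlinarith [mul_nonneg hGq₀ hm₀.le, mul_nonneg hGq₀ hGq₀]
  have hT : 0 ≤ n₀ * (1 / m₀ - G * q₀ / (2 * N₀ * E₀)) * m +
      n₀ * (G * m₀ / (2 * N₀ * E₀)) * q := by positivity
  refine abs_le_of_sq_le_sq' ?_ hT |>.2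
  have h1 : n ^ 2 = m ^ 2 * N / E := by rw [eq_div_iff pE.ne', he]
  have h2 : n₀ ^ 2 = m₀ ^ 2 * N₀ / E₀ := by rw [eq_div_iff pE₀.ne', he₀]
  have h3 : (n₀ * (1 / m₀ - G * q₀ / (2 * N₀ * E₀)) * m + n₀ * (G * m₀ / (2 * N₀ * E₀)) * q) ^ 2 =
      m₀ ^ 2 * N₀ / E₀ * (m / m₀ + G * (m₀ * q - q₀ * m) / (2 * N₀ * E₀)) ^ 2 := by
    rw [← h2]; ring
  rw [h1, h3]
  have h4 : m₀ ^ 2 * N₀ / E₀ * (m / m₀ + G * (m₀ * q - q₀ * m) / (2 * N₀ * E₀)) ^ 2 -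
      m ^ 2 * N / E = (G * (m₀ * q - q₀ * m)) ^ 2 *
        (2 * m / E₀ + m₀ ^ 2 * E / (4 * N₀ * E₀ ^ 2)) / (E₀ * E) := by
    field_simp
    rw [hE, hN, hE₀, hN₀]
    ring
  have h5 : 0 ≤ (G * (m₀ * q - q₀ * m)) ^ 2 *
        (2 * m / E₀ + m₀ ^ 2 * E / (4 * N₀ * E₀ ^ 2)) / (E₀ * E) := by positivity
  linarith

/-- With u = G/(2(1 + 3G)(1 + 2G)) the slope is (1 - u)/h, while h² = 1 - 2u - 4uG < (1 - u)². It
makes the supporting line at β = 0 strictly increasing. -/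
lemma one_lt_tangent_slope {G h : ℝ} (hG : 0 < G) (hh : 0 < h)
    (hsq : h ^ 2 * (1 + 3 * G) = 1 + 2 * G) :
    1 < 1 / h - G * h / (2 * (h + 3 * G * h) * (h + 2 * G * h)) := by
  have e1 : 1 / h - G * h / (2 * (h + 3 * G * h) * (h + 2 * G * h)) =
      (1 - G / (2 * (1 + 3 * G) * (1 + 2 * G))) / h := by
    field_simp
  rw [e1, lt_div_iff₀ hh, one_mul]
  have hu : 0 < G / (2 * (1 + 3 * G) * (1 + 2 * G)) := by positivity
  have hu1 : G / (2 * (1 + 3 * G) * (1 + 2 * G)) < 1 := by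
    rw [div_lt_one (by positivity)]; nlinarith
  have hsq' : h ^ 2 = 1 - 2 * (G / (2 * (1 + 3 * G) * (1 + 2 * G))) * (1 + 2 * G) := by
    rw [show h ^ 2 = (1 + 2 * G) / (1 + 3 * G) by rw [eq_div_iff (by positivity), hsq]]
    field_simp
    ring
  generalize G / (2 * (1 + 3 * G) * (1 + 2 * G)) = u at *
  have : 0 < u * G := mul_pos hu hG
  refine abs_lt_of_sq_lt_sq' ?_ (by linarith) |>.2
  nlinarith

/-- Tangent planes of the concave homogeneous function `m √((m + 3 G q) / (m + 2 G q))`. -/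
lemma exists_tangent_of_homogeneous {G m₀ q₀ n₀ : ℝ} (hG : 0 ≤ G)
    (hm₀ : 0 < m₀) (hq₀ : 0 ≤ q₀) (hn₀ : 0 < n₀)
    (he₀ : n₀ ^ 2 * (m₀ + 2 * G * q₀) = m₀ ^ 2 * (m₀ + 3 * G * q₀)) :
    ∃ A B, 0 < A ∧ 0 ≤ B ∧ A * m₀ + B * q₀ = n₀ ∧ (n₀ = 1 → m₀ = q₀ → 0 < G → 1 < A) ∧
      ∀ m q n, 0 < m → 0 ≤ q → n ^ 2 * (m + 2 * G * q) = m ^ 2 * (m + 3 * G * q) →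
        n ≤ A * m + B * q := by
  have hGq₀ : 0 ≤ G * q₀ := mul_nonneg hG hq₀
  have pE₀ : 0 < m₀ + 2 * G * q₀ := by linarith
  have pN₀ : 0 < m₀ + 3 * G * q₀ := by linarith
  refine ⟨_, _, ?_, ?_, ?_, ?_, fun m q n hm hq he =>
    tangent_of_homogeneous hG hm hq hm₀ hq₀ hn₀ he he₀⟩
  · apply mul_pos hn₀
    rw [sub_pos, div_lt_div_iff₀ (by positivity) hm₀]
    nlinarith [mul_nonneg hGq₀ hm₀.le, mul_nonneg hGq₀ hGq₀, mul_pos hm₀ hm₀]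
  · positivity
  · field_simp
    ring
  · rintro rfl rfl hG'
    rw [one_mul]
    refine one_lt_tangent_slope hG' hm₀ (mul_right_cancel₀ hm₀.ne' ?_)
    linear_combination -he₀

/-- For `h² > 2/3`, the tangent inequality along fixed `a` gives an affine lower bound. -/
lemma affine_le_critBound_of_lt_sq {β₀ h₀ a : ℝ} (h0 : 0 ≤ β₀) (h1 : β₀ < 1)
    (hp : (h₀, a) ∈ critSet β₀) (hh : 0 < h₀) (hk : 2 - 3 * h₀ ^ 2 < 0) :
    ∃ s, (β₀ = 0 → -2 < a → 0 < s) ∧ ∀ β, 0 ≤ β → β ≤ 1 →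
      (β₀ + (1 - β₀) * h₀) * critFactor a + s * (β - β₀) ≤ critBound β := by
  obtain ⟨⟨⟨-, hh1⟩, ⟨ha, -⟩⟩, hr₀, hs⟩ := hp
  simp only at hh1 ha hr₀ hs
  have hq₀ := height_pos h0 h1.le hh
  have ha0 : a < 0 := by
    refine lt_of_le_of_ne (by nlinarith) ?_
    rintro rfl
    have := mul_pos_of_neg_of_neg (neg_lt_zero.2 hq₀) hk
    linarith
  have hw := critDen_pos a
  have hΦ := critFactor_pos a
  set G := (2 - a) ^ 2 * (2 + a) / (2 * (-a) * critDen a) with hG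
  have haw : 0 < 2 * (-a) * critDen a := by have : 0 < -a := by linarith
                                            positivity
  have hG0 : 0 ≤ G := div_nonneg (mul_nonneg (sq_nonneg _) (by linarith)) haw.le
  have hGe : (2 - a) ^ 2 * (2 + a) = G * (2 * (-a) * critDen a) := (div_mul_cancel₀ _ haw.ne').symm
  have rel : ∀ β h, (1 - β) * h * (1 - h ^ 2) * (2 * a * critDen a) =
      (β + (1 - β) * h) * (2 - 3 * h ^ 2) * ((2 - a) ^ 2 * (2 + a)) →
      (1 - β) ^ 2 * ((1 - β) * h + 2 * G * (β + (1 - β) * h)) =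
      ((1 - β) * h) ^ 2 * ((1 - β) * h + 3 * G * (β + (1 - β) * h)) := by
    intro β h hr
    rw [hGe] at hr
    have h2 : (1 - β) * h * (1 - h ^ 2) = -((β + (1 - β) * h) * (2 - 3 * h ^ 2) * G) := by
      apply mul_right_cancel₀ haw.ne'
      linear_combination -hr
    linear_combination (1 - β) ^ 2 * h2
  have he₀ := rel β₀ h₀ hr₀
  have hm₀ : 0 < (1 - β₀) * h₀ := mul_pos (by linarith) hh
  have hn₀ : 0 < 1 - β₀ := by linarith
  obtain ⟨A, B, hA, hB, hEuler, hslope, htan⟩ :=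
    exists_tangent_of_homogeneous hG0 hm₀ hq₀.le hn₀ he₀
  have hF : 0 < A + B := by linarith
  have hq_eq : (β₀ + (1 - β₀) * h₀) * (A + B) = 1 - β₀ + A * β₀ := by
    linear_combination hEuler
  refine ⟨critFactor a * ((A - 1) / (A + B)), ?_, ?_⟩
  · intro hβ ha'
    have hG' : 0 < G := div_pos (mul_pos (by nlinarith) (by linarith)) haw
    have := hslope (by rw [hβ]; ring) (by rw [hβ]; ring) hG'
    exact mul_pos hΦ (div_pos (by linarith) hF)
  · intro β hβ0 hβ1
    obtain ⟨h, hh2, hp⟩ := exists_height_mem_critSet hβ1 ha ha0.le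
    have hhp : 0 < h := lt_of_le_of_ne hp.1.1.1 (by rintro rfl; norm_num at hh2)
    have hq := height_pos hβ0 hβ1 hhp
    -- Since (1 - β)h = q - β, the tangent plane inequality becomes the lower bound q ≥ (1 - β +
    -- Aβ)/(A + B), affine in β.
    have key : 1 - β ≤ A * ((1 - β) * h) + B * (β + (1 - β) * h) := by
      rcases hβ1.eq_or_lt with rfl | hβ1
      · simpa using hB
      · exact htan _ _ _ (mul_pos (by linarith) hhp) hq.le (rel β h hp.2.1)
    refine le_trans ?_ (le_critBound hp)
    have e2 : (β₀ + (1 - β₀) * h₀) * critFactor a +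
        critFactor a * ((A - 1) / (A + B)) * (β - β₀) =
        critFactor a * ((1 - β + A * β) / (A + B)) := by
      field_simp
      linear_combination hq_eq
    rw [e2, critValue, mul_comm (β + (1 - β) * h)]
    refine mul_le_mul_of_nonneg_left ?_ hΦ.le
    rw [div_le_iff₀ hF]
    linarith

/-- The threshold function has a supporting line at every point of `[0, 1]`. -/
lemma exists_affine_le_critBound {β₀ : ℝ} (h0 : 0 ≤ β₀) (h1 : β₀ ≤ 1) :
    ∃ s, ∀ β, 0 ≤ β → β ≤ 1 → critBound β₀ + s * (β - β₀) ≤ critBound β := by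
  rcases h1.eq_or_lt with rfl | h1
  · refine ⟨1, fun β _ _ => ?_⟩
    rw [critBound_one]
    linarith [self_le_critBound β]
  obtain ⟨h, a, hp, he⟩ := exists_eq_critBound β₀
  have hh : 0 < h := height_pos_of_eq_critBound h0 h1 hp.1.1.1 he
  rcases lt_trichotomy (2 - 3 * h ^ 2) 0 with hk | hk | hk
  · obtain ⟨s, -, hs⟩ := affine_le_critBound_of_lt_sq h0 h1 hp hh hk
    exact ⟨s, by rwa [he]⟩
  · have hh1 : h ≤ 1 := hp.1.1.2
    have ha : a = 0 := by
      have hr := hp.2.1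
      simp only at hr
      rw [hk, mul_zero, zero_mul] at hr
      have h2 : 0 < (1 - β₀) * h * (1 - h ^ 2) := mul_pos (mul_pos (by linarith) hh) (by linarith)
      have h3 := (mul_eq_zero.1 hr).resolve_left h2.ne'
      simpa [(critDen_pos a).ne'] using h3
    subst ha
    refine ⟨(1 - h) * critFactor 0, fun β hβ0 hβ1 => ?_⟩
    -- When 3h² = 2 and a = 0 both sides of the relation vanish for every β, so the same pair
    -- competes in every supremum.
    have hp' : (h, (0 : ℝ)) ∈ critSet β :=
      ⟨⟨⟨hh.le, hh1⟩, by norm_num⟩, by simp [hk], by simp⟩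
    refine le_trans (le_of_eq ?_) (le_critBound hp')
    rw [he, critValue]
    ring
  · obtain ⟨⟨-, -, ha2⟩, hr, hs⟩ := hp
    simp only at ha2 hr hs
    have hq := height_pos h0 h1.le hh
    have ha0 : 0 < a := by
      refine lt_of_le_of_ne (nonneg_of_mul_nonneg_right hs hk) ?_
      rintro rfl
      have := mul_pos hq hk
      linarith
    have hw := critDen_pos a
    have h2 : (1 - β₀) * h * (1 - h ^ 2) / (2 - 3 * h ^ 2) =
        (β₀ + (1 - β₀) * h) * ((2 - a) ^ 2 * (2 + a)) / (2 * a * critDen a) := by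
      rw [div_eq_div_iff hk.ne' (by positivity), hr]; ring
    refine ⟨((a ^ 2 + 12) * (1 - h) + 2 * a ^ 2 * (h * (1 - h ^ 2) / (2 - 3 * h ^ 2))) /
      (4 * √(critTheta a)), fun β hβ0 hβ1 => ?_⟩
    refine le_trans (le_of_eq ?_) (affine_le_critBound_of_sq_lt hβ0 hβ1 hh hk ha0.le ha2)
    have hΘ := Real.sqrt_pos.2 (critTheta_pos a)
    have e1 : critBound β₀ = ((a ^ 2 + 12) * (β₀ + (1 - β₀) * h) -
        2 * a ^ 2 * ((1 - β₀) * h * (1 - h ^ 2) / (2 - 3 * h ^ 2))) / (4 * √(critTheta a)) := by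
      rw [he, ← critFactor_tangent_self ha0, h2]
      field_simp
    rw [e1]
    field_simp
    ring

/-! ### The threshold for the eccentricity -/

/-- The convexity threshold for `ε` as a function of `β`. -/
def epsConv (β : ℝ) : ℝ := √(1 - critBound β ^ 2)

lemma convex_critBound {x y s t : ℝ} (hx : x ∈ Set.Icc (0 : ℝ) 1) (hy : y ∈ Set.Icc (0 : ℝ) 1)
    (hs : 0 ≤ s) (ht : 0 ≤ t) (hst : s + t = 1) :
    critBound (s * x + t * y) ≤ s * critBound x + t * critBound y := by
  have hz : s * x + t * y ∈ Set.Icc (0 : ℝ) 1 := convex_Icc (0 : ℝ) 1 hx hy hs ht hst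
  obtain ⟨k, hk⟩ := exists_affine_le_critBound hz.1 hz.2
  have h1 := mul_le_mul_of_nonneg_left (hk x hx.1 hx.2) hs
  have h2 := mul_le_mul_of_nonneg_left (hk y hy.1 hy.2) ht
  have e : t = 1 - s := by linarith
  subst e
  linarith

/-- The map u ↦ √(1 - u²) is decreasing and concave on [0, 1], and `critBound` is convex. -/
lemma concaveOn_epsConv : ConcaveOn ℝ (Set.Icc 0 1) epsConv := by
  refine ⟨convex_Icc 0 1, fun x hx y hy s t hs ht hst => ?_⟩
  simp only [smul_eq_mul, epsConv]
  have hc := convex_critBound hx hy hs ht hst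
  have h0 := critBound_pos (s * x + t * y)
  have hx0 := critBound_pos x
  have hy0 := critBound_pos y
  have hx1 := critBound_le_one hx.2
  have hy1 := critBound_le_one hy.2
  set u := critBound x
  set v := critBound y
  have hu : √(1 - u ^ 2) ^ 2 = 1 - u ^ 2 := Real.sq_sqrt (by nlinarith)
  have hv : √(1 - v ^ 2) ^ 2 = 1 - v ^ 2 := Real.sq_sqrt (by nlinarith)
  have hu0 := Real.sqrt_nonneg (1 - u ^ 2)
  have hv0 := Real.sqrt_nonneg (1 - v ^ 2)
  apply Real.le_sqrt_of_sq_le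
  have h1 : critBound (s * x + t * y) ^ 2 ≤ (s * u + t * v) ^ 2 := pow_le_pow_left₀ h0.le hc 2
  have h2 : √(1 - u ^ 2) * √(1 - v ^ 2) ≤ 1 - u * v := by
    nlinarith [sq_nonneg (√(1 - u ^ 2) - √(1 - v ^ 2)), sq_nonneg (u - v)]
  have h3 := mul_le_mul_of_nonneg_left h2 (mul_nonneg hs ht)
  have e : 1 - (s * u + t * v) ^ 2 =
      s ^ 2 * (1 - u ^ 2) + t ^ 2 * (1 - v ^ 2) + 2 * (s * t * (1 - u * v)) := by
    linear_combination -(s + t + 1) * hst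
  nlinarith

lemma epsConv_one : epsConv 1 = 0 := by simp [epsConv, critBound_one]

lemma epsConv_mem (β : ℝ) : epsConv β ∈ Set.Icc (0 : ℝ) 1 :=
  ⟨Real.sqrt_nonneg _, by
    rw [epsConv, Real.sqrt_le_left one_pos.le]
    nlinarith [sq_nonneg (critBound β)]⟩

lemma epsConv_mem_paramDomain {β : ℝ} (h0 : 0 < β) (h1 : β < 1) : (β, epsConv β) ∈ paramDomain := by
  have hb := critBound_pos β
  have hl := lt_critBound h0.le h1
  have h2 : 0 < 1 - critBound β ^ 2 := by nlinarith [critBound_lt_one h1]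
  have h3 : 0 < epsConv β := Real.sqrt_pos.2 h2
  have h4 : epsConv β ^ 2 = 1 - critBound β ^ 2 := Real.sq_sqrt h2.le
  refine ⟨by positivity, ?_, h0, h3⟩
  simp only
  nlinarith

/-! ### The threshold at `β = 0` -/

/-- The cubic `a³ - 2a² - 28a + 24`. -/
def critCubic (a : ℝ) : ℝ := a ^ 3 - 2 * a ^ 2 - 28 * a + 24

lemma critCubic_eq (a : ℝ) : critCubic a = 3 * ((2 - a) ^ 2 * (2 + a)) - 2 * a * critDen a := by
  unfold critCubic critDen; ring

/-- The value `1 - ε_conv(0)²`. -/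
def critZero : ℝ := (95 - 7 * √17) / 128

lemma sqrt_seventeen_bounds : 4.123 < √17 ∧ √17 < 4.124 :=
  ⟨Real.lt_sqrt_of_sq_lt (by norm_num), by rw [Real.sqrt_lt' (by norm_num)]; norm_num⟩

/-- The squared factor records that (3 - √17)/2 is a critical point of the function maximised at β =
0, with maximum `critZero`. -/
lemma critZero_factor (a : ℝ) :
    critZero * (critCubic a * critDen a ^ 2) - 32 * (2 - 3 * a) * critTheta a =
      (a - (3 - √17) / 2) ^ 2 * ((69 + 3 * √17) + (-36 + 4 * √17) * a +
        (365 + 27 * √17) / 16 * a ^ 2 + a ^ 3 * ((-9 + 33 * √17) / 32 -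
        (83 + 37 * √17) / 64 * a + (95 - 7 * √17) / 128 * a ^ 2)) := by
  have hs : √17 ^ 2 = 17 := Real.sq_sqrt (by norm_num)
  have hs3 : √17 ^ 3 = 17 * √17 := by rw [pow_succ, hs]
  unfold critZero critCubic critDen critTheta
  ring_nf
  rw [hs3, hs]
  ring

/-- At β = 0 one has h² = 8(2 - 3a)/`critCubic a`, so this says h²Φ(a)² ≤ `critZero`. For a > 2/3
the left side is negative; below, the cofactor in `critZero_factor` is nonnegative. -/
lemma critZero_bound {a : ℝ} (ha : -2 ≤ a) (hM : 0 < critCubic a) :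
    32 * (2 - 3 * a) * critTheta a ≤ critZero * (critCubic a * critDen a ^ 2) := by
  obtain ⟨hs1, hs2⟩ := sqrt_seventeen_bounds
  have hΘ := critTheta_pos a
  have hw := critDen_pos a
  rcases le_total a (2 / 3) with h | h
  · rw [← sub_nonneg, critZero_factor]
    apply mul_nonneg (sq_nonneg _)
    set s := √17
    rcases le_total 0 a with h0 | h0
    · have e1 : 0 ≤ (69 + 3 * s) + (-36 + 4 * s) * a := by nlinarith
      have e2 : 0 ≤ (365 + 27 * s) / 16 * a ^ 2 := by positivity
      have e3 : 0 ≤ (-9 + 33 * s) / 32 - (83 + 37 * s) / 64 * a := by nlinarith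
      have e4 : 0 ≤ (95 - 7 * s) / 128 * a ^ 2 :=
        mul_nonneg (by linarith) (sq_nonneg _)
      have e5 : 0 ≤ a ^ 3 := by positivity
      have e6 := mul_nonneg e5 (add_nonneg e3 e4)
      linarith
    · have e1 : 0 ≤ (-36 + 4 * s) * a := mul_nonneg_of_nonpos_of_nonpos (by linarith) h0
      have e2 : (-9 + 33 * s) / 32 - (83 + 37 * s) / 64 * a + (95 - 7 * s) / 128 * a ^ 2 ≤ 14 := by
        have : a ^ 2 ≤ 4 := by nlinarith
        nlinarith
      have e3 : a ^ 3 * 14 ≤ a ^ 3 * ((-9 + 33 * s) / 32 - (83 + 37 * s) / 64 * a +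
          (95 - 7 * s) / 128 * a ^ 2) :=
        mul_le_mul_of_nonpos_left e2 (by nlinarith [sq_nonneg a])
      have e4 : 0 ≤ a ^ 2 * (a + 2) := mul_nonneg (sq_nonneg _) (by linarith)
      have e5 : 28 * a ^ 2 ≤ (365 + 27 * s) / 16 * a ^ 2 :=
        mul_le_mul_of_nonneg_right (by linarith) (sq_nonneg a)
      linarith
  · have h1 : 32 * (2 - 3 * a) * critTheta a ≤ 0 :=
      mul_nonpos_of_nonpos_of_nonneg (by linarith) hΘ.le
    have h2 : 0 < critZero := by unfold critZero; linarith
    exact h1.trans (by positivity)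

lemma critBound_zero_sq_le : critBound 0 ^ 2 ≤ critZero := by
  obtain ⟨h, a, hp, he⟩ := exists_eq_critBound 0
  have hh : 0 < h := height_pos_of_eq_critBound le_rfl one_pos hp.1.1.1 he
  obtain ⟨ρ, hρ, h1, h2⟩ := exists_scale_of_mem_critSet le_rfl one_pos hp hh
  rw [he]
  simp only [sub_zero, one_mul, zero_add] at *
  -- Three times the first scale relation minus the second eliminates h³.
  have hM : h = ρ * critCubic a := by
    rw [critCubic_eq]; linear_combination 3 * h1 - h2
  have hM0 : 0 < critCubic a := by
    by_contra! hc
    nlinarith [mul_nonneg hρ.le (neg_nonneg.2 hc)]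
  have hh2 : h ^ 2 * critCubic a = 8 * (2 - 3 * a) := by
    have e1 : (h ^ 2 * critCubic a - 8 * (2 - 3 * a)) * ρ = 0 := by
      have : critCubic a - (2 - a) ^ 2 * (2 + a) = 8 * (2 - 3 * a) := by unfold critCubic; ring
      linear_combination (-h ^ 2 + 1) * hM + ρ * this - h1
    have := (mul_eq_zero.1 e1).resolve_right hρ.ne'
    linarith
  have hw := critDen_pos a
  rw [mul_pow, critFactor_sq, mul_div_assoc', div_le_iff₀ (by positivity)]
  have hb := critZero_bound hp.1.2.1 hM0
  refine le_of_mul_le_mul_right ?_ hM0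
  calc h ^ 2 * (4 * critTheta a) * critCubic a = 32 * (2 - 3 * a) * critTheta a := by
        linear_combination 4 * critTheta a * hh2
    _ ≤ _ := hb
    _ = _ := by ring

/-- The point of degeneracy at `β = 0`. -/
lemma exists_mem_critSet_zero : ∃ h a, (h, a) ∈ critSet 0 ∧ 0 < h ∧ 2 - 3 * h ^ 2 < 0 ∧ -2 < a ∧
    (h * critFactor a) ^ 2 = critZero := by
  obtain ⟨hs1, hs2⟩ := sqrt_seventeen_bounds
  obtain ⟨a, ha⟩ : ∃ a, a = (3 - √17) / 2 := ⟨_, rfl⟩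
  have ha1 : -0.5625 < a := by linarith
  have ha2 : a < -0.56 := by linarith
  have hw := critDen_pos a
  have hM : 0 < critCubic a := by
    unfold critCubic
    nlinarith [mul_pos (by linarith : 0 < -a) (by linarith : 0 < 2 + a),
      mul_nonneg (sq_nonneg a) (by linarith : 0 ≤ a + 0.5625)]
  have hN : 0 < (2 - a) ^ 2 * (2 + a) := mul_pos (by nlinarith) (by linarith)
  have hsq : √(8 * (2 - 3 * a) / critCubic a) ^ 2 = 8 * (2 - 3 * a) / critCubic a :=
    Real.sq_sqrt (div_nonneg (by linarith) hM.le)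
  have hpos : 0 < √(8 * (2 - 3 * a) / critCubic a) :=
    Real.sqrt_pos.2 (div_pos (by linarith) hM)
  set h := √(8 * (2 - 3 * a) / critCubic a)
  have hX : 1 - h ^ 2 = (2 - a) ^ 2 * (2 + a) / critCubic a := by
    rw [hsq, eq_div_iff hM.ne', sub_mul, div_mul_cancel₀ _ hM.ne']
    unfold critCubic; ring
  have hk : 2 - 3 * h ^ 2 = 2 * a * critDen a / critCubic a := by
    rw [hsq, eq_div_iff hM.ne', sub_mul, mul_assoc, div_mul_cancel₀ _ hM.ne']
    unfold critCubic critDen; ring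
  have hh1 : h ≤ 1 := by
    have : 0 < 1 - h ^ 2 := by rw [hX]; positivity
    nlinarith
  have hk0 : 2 - 3 * h ^ 2 < 0 := by
    rw [hk]
    exact div_neg_of_neg_of_pos (mul_neg_of_neg_of_pos (by linarith) hw) hM
  refine ⟨h, a, ⟨⟨⟨hpos.le, hh1⟩, by linarith, by linarith⟩, ?_, ?_⟩, hpos, hk0, by linarith, ?_⟩
  · simp only
    rw [hX, hk]; ring
  · exact mul_nonneg_of_nonpos_of_nonpos hk0.le (by linarith)
  · have := critZero_factor a
    rw [← ha, sub_self, zero_pow two_ne_zero, zero_mul, sub_eq_zero] at this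
    rw [mul_pow, hsq, critFactor_sq, div_mul_div_comm, div_eq_iff (by positivity), this]
    ring

lemma critBound_zero_sq : critBound 0 ^ 2 = critZero := by
  refine le_antisymm critBound_zero_sq_le ?_
  obtain ⟨h, a, hp, hh, -, -, he⟩ := exists_mem_critSet_zero
  rw [← he]
  have := le_critBound hp
  simp only [critValue, sub_zero, one_mul, zero_add] at this
  exact pow_le_pow_left₀ (mul_nonneg hh.le (critFactor_pos a).le) this 2

lemma epsConv_zero : epsConv 0 = (7 + √17) / 16 := by
  have hs : √17 ^ 2 = 17 := Real.sq_sqrt (by norm_num)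
  rw [epsConv, critBound_zero_sq, Real.sqrt_eq_iff_mul_self_eq_of_pos (by positivity), critZero]
  linear_combination hs / 256

lemma critBound_zero_lt {β : ℝ} (h0 : 0 < β) (h1 : β ≤ 1) : critBound 0 < critBound β := by
  obtain ⟨h, a, hp, hh, hk, ha, he⟩ := exists_mem_critSet_zero
  obtain ⟨s, hs, hle⟩ := affine_le_critBound_of_lt_sq le_rfl one_pos hp hh hk
  have := hle β h0.le h1
  simp only [sub_zero, one_mul, zero_add] at this
  have e : critBound 0 = h * critFactor a := by
    rw [← critBound_zero_sq] at he
    exact ((pow_left_inj₀ (mul_nonneg hh.le (critFactor_pos a).le) (critBound_pos 0).le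
      two_ne_zero).1 he).symm
  have := mul_pos (hs rfl ha) h0
  linarith

lemma epsConv_lt_zero {β : ℝ} (h0 : 0 < β) (h1 : β ≤ 1) : epsConv β < epsConv 0 := by
  have h2 := critBound_zero_lt h0 h1
  have h3 := critBound_pos 0
  apply Real.sqrt_lt_sqrt
  · nlinarith [critBound_le_one h1]
  · nlinarith

/-- A concave function on [0, 1] that is below its value at 0 everywhere else is strictly
decreasing: compare x with the chord from 0 to y. -/
lemma strictAntiOn_epsConv : StrictAntiOn epsConv (Set.Icc 0 1) := by
  intro x hx y hy hxy
  rcases hx.1.eq_or_lt with rfl | hx0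
  · exact epsConv_lt_zero hxy hy.2
  have hy0 : 0 < y := hx0.trans hxy
  have := concaveOn_epsConv.2 (Set.left_mem_Icc.2 zero_le_one) hy
    (div_nonneg (sub_nonneg.2 hxy.le) hy0.le) (div_nonneg hx0.le hy0.le)
    (by field_simp; ring)
  simp only [smul_eq_mul, mul_zero, zero_add, div_mul_cancel₀ _ hy0.ne'] at this
  have h2 := mul_lt_mul_of_pos_left (epsConv_lt_zero hy0 hy.2)
    (div_pos (sub_pos.2 hxy) hy0)
  have h3 : (y - x) / y * epsConv y + x / y * epsConv y = epsConv y := by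
    field_simp; ring
  linarith

/-! ### Second derivatives along lines and convexity of sublevel sets -/

section Lines

variable {E : Type*} [NormedAddCommGroup E] [NormedSpace ℝ E] {F : E → ℝ} {x : E}

lemma eventually_hasDerivAt_line (hF : ContDiffAt ℝ 2 F x) (v : E) :
    ∀ᶠ t : ℝ in 𝓝 0, HasDerivAt (fun t : ℝ => F (x + t • v)) (fderiv ℝ F (x + t • v) v) t := by
  have h1 : ∀ᶠ y in 𝓝 x, DifferentiableAt ℝ F y :=
    (hF.eventually (by simp)).mono fun y hy => hy.differentiableAt (by norm_num)
  have h2 : Tendsto (fun t : ℝ => x + t • v) (𝓝 0) (𝓝 x) := by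
    have : Continuous fun t : ℝ => x + t • v := by fun_prop
    simpa using this.tendsto 0
  filter_upwards [h2.eventually h1] with t ht
  have h3 : HasDerivAt (fun t : ℝ => x + t • v) v t := by
    simpa using ((hasDerivAt_id t).smul_const v).const_add x
  exact ht.hasFDerivAt.comp_hasDerivAt t h3

lemma deriv_line (hF : ContDiffAt ℝ 2 F x) (v : E) :
    deriv (fun t : ℝ => F (x + t • v)) 0 = fderiv ℝ F x v := by
  simpa using (eventually_hasDerivAt_line hF v).self_of_nhds.deriv

lemma deriv_deriv_line (hF : ContDiffAt ℝ 2 F x) (v : E) :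
    deriv (deriv (fun t : ℝ => F (x + t • v))) 0 = fderiv ℝ (fderiv ℝ F) x v v := by
  have h1 : deriv (fun t : ℝ => F (x + t • v)) =ᶠ[𝓝 0] fun t => fderiv ℝ F (x + t • v) v :=
    (eventually_hasDerivAt_line hF v).mono fun t ht => ht.deriv
  rw [h1.deriv_eq]
  have h2 : DifferentiableAt ℝ (fderiv ℝ F) x :=
    (hF.fderiv_right (m := 1) (by norm_num)).differentiableAt (by norm_num)
  have h3 : HasDerivAt (fun t : ℝ => x + t • v) v 0 := by
    simpa using ((hasDerivAt_id (0 : ℝ)).smul_const v).const_add x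
  have h4 : HasFDerivAt (fderiv ℝ F) (fderiv ℝ (fderiv ℝ F) x) (x + (0 : ℝ) • v) := by
    simpa using h2.hasFDerivAt
  have h5 : HasDerivAt (fun t : ℝ => fderiv ℝ F (x + t • v)) (fderiv ℝ (fderiv ℝ F) x v) 0 :=
    h4.comp_hasDerivAt (0 : ℝ) h3
  have h6 : HasDerivAt (fun t : ℝ => fderiv ℝ F (x + t • v) v) (fderiv ℝ (fderiv ℝ F) x v v) 0 :=
    (ContinuousLinearMap.apply ℝ ℝ v).hasFDerivAt.comp_hasDerivAt (0 : ℝ) h5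
  exact h6.deriv

lemma continuousAt_line (hF : ContDiffAt ℝ 2 F x) (v : E) :
    ContinuousAt (fun t : ℝ => F (x + t • v)) 0 :=
  (eventually_hasDerivAt_line hF v).self_of_nhds.continuousAt

/-- At a local maximum along a line the second derivative is not positive. -/
lemma not_isLocalMax_line (hF : ContDiffAt ℝ 2 F x) {v : E} (h1 : fderiv ℝ F x v = 0)
    (h2 : 0 < fderiv ℝ (fderiv ℝ F) x v v) : ¬ IsLocalMax (fun t : ℝ => F (x + t • v)) 0 := by
  intro hmax
  rw [← deriv_deriv_line hF v] at h2
  have hmin := isLocalMin_of_deriv_deriv_pos h2 ((deriv_line hF v).trans h1)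
    (continuousAt_line hF v)
  have hconst : (fun t : ℝ => F (x + t • v)) =ᶠ[𝓝 0] fun _ => F (x + (0 : ℝ) • v) := by
    filter_upwards [hmax, hmin] with t ht1 ht2
    exact le_antisymm ht1 ht2
  have h3 : deriv (fun t : ℝ => F (x + t • v)) =ᶠ[𝓝 0] fun _ => 0 := by
    refine hconst.deriv.trans (Eventually.of_forall fun t => ?_)
    simp
  rw [h3.deriv_eq] at h2
  simp at h2

/-- A critical point with negative second derivative along a line is a strict local maximum. -/
lemma eventually_lt_line (hF : ContDiffAt ℝ 2 F x) {v : E} (h1 : fderiv ℝ F x v = 0)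
    (h2 : fderiv ℝ (fderiv ℝ F) x v v < 0) :
    ∀ᶠ t : ℝ in 𝓝[≠] 0, F (x + t • v) < F x := by
  -- With this k, adding k t² only halves the negative second derivative. The sum still has a local
  -- maximum, which makes the maximum of F itself strict.
  set k := -fderiv ℝ (fderiv ℝ F) x v v / 4 with hk
  have hk0 : 0 < k := by rw [hk]; linarith
  have hev := eventually_hasDerivAt_line hF v
  have hq : ∀ t : ℝ, HasDerivAt (fun t : ℝ => k * t ^ 2) (2 * k * t) t := fun t => by
    have := (hasDerivAt_pow 2 t).const_mul k
    simpa [mul_assoc, mul_left_comm] using this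
  have hd : deriv (fun t : ℝ => F (x + t • v) + k * t ^ 2) =ᶠ[𝓝 0]
      fun t => deriv (fun t : ℝ => F (x + t • v)) t + 2 * k * t := by
    filter_upwards [hev] with t ht
    rw [ht.deriv]
    exact (ht.add (hq t)).deriv
  have hd2 : DifferentiableAt ℝ (deriv (fun t : ℝ => F (x + t • v))) 0 := by
    apply differentiableAt_of_deriv_ne_zero
    rw [deriv_deriv_line hF v]; exact h2.ne
  have hl : HasDerivAt (fun t : ℝ => 2 * k * t) (2 * k) 0 := by
    simpa using (hasDerivAt_id (0 : ℝ)).const_mul (2 * k)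
  have hmax : IsLocalMax (fun t : ℝ => F (x + t • v) + k * t ^ 2) 0 := by
    apply isLocalMax_of_deriv_deriv_neg
    · have e : deriv (fun t => deriv (fun t : ℝ => F (x + t • v)) t + 2 * k * t) 0 =
          fderiv ℝ (fderiv ℝ F) x v v + 2 * k := by
        rw [← deriv_deriv_line hF v]
        exact (hd2.hasDerivAt.add hl).deriv
      rw [hd.deriv_eq, e]
      linarith
    · rw [hd.self_of_nhds]
      beta_reduce
      rw [deriv_line hF v, h1]; simp
    · exact (continuousAt_line hF v).add (hq 0).continuousAt
  filter_upwards [hmax.filter_mono nhdsWithin_le_nhds, self_mem_nhdsWithin] with t ht htne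
  have : 0 < t ^ 2 := by have : t ≠ 0 := htne
                         positivity
  have hkt := mul_pos hk0 this
  simp only [zero_smul, add_zero] at ht
  linarith

end Lines

section Sublevel

variable {E : Type*} [NormedAddCommGroup E] [NormedSpace ℝ E] {F : E → ℝ} {U : Set E} {c : ℝ}

/-- A connected sublevel set whose boundary has positive curvature is convex. -/
theorem convex_sublevel_of_pos_curvature (hU : IsOpen U) (hUc : Convex ℝ U)
    (hF : ∀ x ∈ U, ContDiffAt ℝ 2 F x) (hconn : IsPreconnected {x | x ∈ U ∧ F x < c})
    (hpos : ∀ x ∈ U, F x = c → ∀ v, v ≠ 0 → fderiv ℝ F x v = 0 →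
      0 < fderiv ℝ (fderiv ℝ F) x v v) :
    Convex ℝ {x | x ∈ U ∧ F x < c} := by
  have hcont : ContinuousOn F U := fun x hx => (hF x hx).continuousAt.continuousWithinAt
  have hW : IsOpen {x | x ∈ U ∧ F x < c} := hcont.isOpen_inter_preimage hU isOpen_Iio
  rw [convex_iff_segment_subset]
  intro x hx
  have hline : Continuous fun p : E × ℝ => x + p.2 • (p.1 - x) := by fun_prop
  let T : Set E := {y | ∀ t ∈ Set.Icc (0 : ℝ) 1, x + t • (y - x) ∈ {x | x ∈ U ∧ F x < c}}
  have hT : IsOpen T := by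
    rw [isOpen_iff_mem_nhds]
    intro y hy
    refine isCompact_Icc.eventually_forall_of_forall_eventually fun t ht => ?_
    exact hline.continuousAt.eventually (hW.mem_nhds (hy t ht))
  have hsub : {x | x ∈ U ∧ F x < c} ⊆ T := by
    -- The points visible from x inside the sublevel set form an open set. It is also closed
    -- relative to the sublevel set: a limit segment stays in F ≤ c, and touching F = c would give a
    -- local maximum along a tangent line, against positive curvature.
    refine hconn.subset_of_closure_inter_subset hT ⟨x, hx, fun t _ => by simpa using hx⟩ ?_
    rintro y ⟨hyT, hy⟩ t ht
    have hmemU : ∀ s ∈ Set.Icc (0 : ℝ) 1, x + s • (y - x) ∈ U := fun s hs =>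
      hUc.add_smul_sub_mem hx.1 hy.1 hs
    have hle : ∀ s ∈ Set.Icc (0 : ℝ) 1, F (x + s • (y - x)) ≤ c := by
      intro s hs
      have hcl : ContinuousAt (fun z => F (x + s • (z - x))) y := by
        have h1 : ContinuousAt F (x + s • (y - x)) := (hF _ (hmemU s hs)).continuousAt
        exact ContinuousAt.comp (f := fun z => x + s • (z - x)) h1 (by fun_prop)
      have := mem_closure_iff_frequently.1 hyT
      exact le_of_tendsto_of_frequently hcl (this.mono fun z hz => (hz s hs).2.le)
    refine ⟨hmemU t ht, lt_of_le_of_ne (hle t ht) fun heq => ?_⟩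
    have ht0 : 0 < t := lt_of_le_of_ne ht.1 fun h => by
      rw [← h, zero_smul, add_zero] at heq; exact hx.2.ne heq
    have ht1 : t < 1 := lt_of_le_of_ne ht.2 fun h => by
      rw [h, one_smul, add_sub_cancel] at heq; exact hy.2.ne heq
    have hne : y - x ≠ 0 := fun h => by
      rw [h, smul_zero, add_zero] at heq; exact hx.2.ne heq
    set p := x + t • (y - x) with hp
    have hmax : IsLocalMax (fun s : ℝ => F (p + s • (y - x))) 0 := by
      have : ∀ᶠ s : ℝ in 𝓝 0, t + s ∈ Set.Icc (0 : ℝ) 1 := by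
        have h1 : Tendsto (fun s : ℝ => t + s) (𝓝 0) (𝓝 t) := by
          simpa using (continuous_const_add t).tendsto 0
        exact h1.eventually_mem (Icc_mem_nhds ht0 ht1)
      filter_upwards [this] with s hs
      have e : p + s • (y - x) = x + (t + s) • (y - x) := by rw [hp, add_smul, add_assoc]
      rw [e, zero_smul, add_zero, heq]
      exact hle _ hs
    have hFp := hF p (hmemU t ht)
    have h1 : fderiv ℝ F p (y - x) = 0 := by
      rw [← deriv_line hFp]; exact hmax.deriv_eq_zero
    exact not_isLocalMax_line hFp h1 (hpos p (hmemU t ht) heq _ hne h1) hmax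
  intro y hy
  rw [segment_eq_image']
  rintro _ ⟨t, ht, rfl⟩
  exact hsub hy t ht

/-- If a convex set contains an open sublevel set of `F`, then at boundary points in the level
set the second derivative of `F` is nonnegative on tangent vectors. -/
lemma nonneg_of_mem_frontier {K : Set E} {x : E} (hK : Convex ℝ K) (hx : x ∈ frontier K)
    (hF : ContDiffAt ℝ 2 F x) (hU : U ∈ 𝓝 x) (hW : IsOpen {y | y ∈ U ∧ F y < F x})
    (hWK : {y | y ∈ U ∧ F y < F x} ⊆ K) {v : E} (hv : fderiv ℝ F x v = 0) :
    0 ≤ fderiv ℝ (fderiv ℝ F) x v v := by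
  by_contra! hneg
  have hlt := eventually_lt_line hF hv hneg
  have hlt' := eventually_lt_line hF (v := -v) (by simpa using hv) (by simpa using hneg)
  have hUl : ∀ w : E, ∀ᶠ t : ℝ in 𝓝[≠] 0, x + t • w ∈ U := fun w => by
    have : ContinuousAt (fun t : ℝ => x + t • w) 0 := by fun_prop
    exact (this.eventually (by simpa using hU)).filter_mono nhdsWithin_le_nhds
  -- Both x + tv and x - tv lie in the open sublevel set, hence in the interior of K, and so does
  -- their midpoint x.
  obtain ⟨t, ⟨⟨h1, h2⟩, h3⟩, h4⟩ := (((hlt.and hlt').and (hUl v)).and (hUl (-v))).exists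
  have hint := interior_maximal hWK hW
  have hmid := hK.interior (hint ⟨h3, h1⟩) (hint ⟨h4, h2⟩) (a := 1 / 2) (b := 1 / 2)
    (by norm_num) (by norm_num) (by norm_num)
  have e : (1 / 2 : ℝ) • (x + t • v) + (1 / 2 : ℝ) • (x + t • (-v)) = x := by
    module
  rw [e] at hmid
  exact hx.2 hmid

end Sublevel

/-! ### The potential along lines -/

/-- The function `-1 - V` in rescaled coordinates, where `c = 1 - ε²`. -/
def hillFn (β c r z : ℝ) : ℝ :=
  -1 - c / r ^ 2 + 2 * β / r + 2 * (1 - β) / √(r ^ 2 + z ^ 2)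

/-- The derivative of `hillFn` in the direction `(u, w)`. -/
def hillD (β c u w r z : ℝ) : ℝ :=
  2 * c * u / r ^ 3 - 2 * β * u / r ^ 2 - 2 * (1 - β) * (r * u + z * w) / √(r ^ 2 + z ^ 2) ^ 3

/-- The second derivative of `hillFn` in the direction `(u, w)`. -/
def hillDD (β c u w r z : ℝ) : ℝ :=
  -6 * c * u ^ 2 / r ^ 4 + 4 * β * u ^ 2 / r ^ 3 +
    2 * (1 - β) * (3 * (r * u + z * w) ^ 2 / √(r ^ 2 + z ^ 2) ^ 5 -
      (u ^ 2 + w ^ 2) / √(r ^ 2 + z ^ 2) ^ 3)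

section

variable {r u : ℝ} {t : ℝ}

lemma hasDerivAt_affine (r u t : ℝ) : HasDerivAt (fun t : ℝ => r + t * u) u t := by
  simpa using ((hasDerivAt_id t).mul_const u).const_add r

lemma hasDerivAt_sqrt_line (hr : 0 < r + t * u) (z w : ℝ) :
    HasDerivAt (fun t : ℝ => √((r + t * u) ^ 2 + (z + t * w) ^ 2))
      (((r + t * u) * u + (z + t * w) * w) / √((r + t * u) ^ 2 + (z + t * w) ^ 2)) t := by
  have h1 : HasDerivAt (fun t : ℝ => (r + t * u) ^ 2 + (z + t * w) ^ 2)
      (2 * ((r + t * u) * u + (z + t * w) * w)) t := by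
    refine (((hasDerivAt_affine r u t).pow 2).add ((hasDerivAt_affine z w t).pow 2)).congr_deriv ?_
    norm_num
    ring
  have hpos : 0 < (r + t * u) ^ 2 + (z + t * w) ^ 2 := by positivity
  convert h1.sqrt hpos.ne' using 1
  rw [mul_div_mul_left _ _ two_ne_zero]

lemma hasDerivAt_hillFn_line (β c : ℝ) (hr : 0 < r + t * u) (z w : ℝ) :
    HasDerivAt (fun t : ℝ => hillFn β c (r + t * u) (z + t * w))
      (hillD β c u w (r + t * u) (z + t * w)) t := by
  have hR : 0 < √((r + t * u) ^ 2 + (z + t * w) ^ 2) := Real.sqrt_pos.2 (by positivity)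
  have h1 := hasDerivAt_affine r u t
  have h2 := hasDerivAt_sqrt_line hr z w
  have h3 := (((((hasDerivAt_const t c).div (h1.pow 2) (pow_pos hr 2).ne').const_sub (-1)).add
    ((hasDerivAt_const t (2 * β)).div h1 hr.ne')).add
    ((hasDerivAt_const t (2 * (1 - β))).div h2 hR.ne'))
  refine h3.congr_deriv ?_
  unfold hillD
  simp only [Pi.pow_apply]
  field_simp
  norm_num
  ring

lemma hasDerivAt_hillD_line (β c : ℝ) (hr : 0 < r + t * u) (z w : ℝ) :
    HasDerivAt (fun t : ℝ => hillD β c u w (r + t * u) (z + t * w))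
      (hillDD β c u w (r + t * u) (z + t * w)) t := by
  have hR : 0 < √((r + t * u) ^ 2 + (z + t * w) ^ 2) := Real.sqrt_pos.2 (by positivity)
  have h1 := hasDerivAt_affine r u t
  have h1' := hasDerivAt_affine z w t
  have h2 := hasDerivAt_sqrt_line hr z w
  have h3 := (((hasDerivAt_const t (2 * c * u)).div (h1.pow 3) (pow_pos hr 3).ne').sub
    ((hasDerivAt_const t (2 * β * u)).div (h1.pow 2) (pow_pos hr 2).ne')).sub
    ((((h1.mul_const u).add (h1'.mul_const w)).const_mul (2 * (1 - β))).div (h2.pow 3)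
      (pow_pos hR 3).ne')
  refine h3.congr_deriv ?_
  unfold hillDD
  simp only [Pi.pow_apply, Pi.add_apply]
  field_simp
  norm_num
  ring

end

/-! ### Algebra of the first and second derivatives -/

/-- The value of `hillFn` in terms of `y = 1 / r` and `q = β + (1 - β) r / √(r² + z²)`. -/
def profile (c q y : ℝ) : ℝ := -1 - c * y ^ 2 + 2 * q * y

/-- The radial coefficient of `2 U D²U - ∇U ⊗ ∇U`. -/
def radialCoeff (c q y : ℝ) : ℝ := profile c q y * (2 * q - 3 * c * y) - y * (c * y - q) ^ 2

/-- The determinant of `2 U D²U - ∇U ⊗ ∇U`, up to positive factors. -/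
def detCoeff (c q y k n : ℝ) : ℝ := radialCoeff c q y * k + n * (1 - 3 * profile c q y)

/-- The first derivative in the direction with components `u` (radial) and `s` (angular). -/
def firstForm (c q y μ w u s : ℝ) : ℝ := 2 * y ^ 2 * (u * (c * y - q) - μ * w * s)

/-- The second derivative in the direction with components `u` (radial) and `s` (angular). -/
def secondForm (c q y μ w k u s : ℝ) : ℝ :=
  2 * y ^ 3 * (u ^ 2 * (2 * q - 3 * c * y) + 4 * μ * w * u * s + μ * k * s ^ 2)

section

variable {r : ℝ}

lemma hillFn_eq_profile (β c : ℝ) (hr : 0 < r) (z : ℝ) :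
    hillFn β c r z = profile c (β + (1 - β) * (r / √(r ^ 2 + z ^ 2))) (1 / r) := by
  have hR : 0 < √(r ^ 2 + z ^ 2) := Real.sqrt_pos.2 (by positivity)
  unfold hillFn profile
  field_simp
  ring

lemma hillD_eq_firstForm (β c : ℝ) (hr : 0 < r) (z u w : ℝ) :
    hillD β c u w r z = firstForm c (β + (1 - β) * (r / √(r ^ 2 + z ^ 2))) (1 / r)
      ((1 - β) * (r / √(r ^ 2 + z ^ 2)) ^ 3) (z / r) u (w - z / r * u) := by
  have hR : 0 < √(r ^ 2 + z ^ 2) := Real.sqrt_pos.2 (by positivity)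
  have hR2 : √(r ^ 2 + z ^ 2) ^ 2 = r ^ 2 + z ^ 2 := Real.sq_sqrt (by positivity)
  unfold hillD firstForm
  generalize √(r ^ 2 + z ^ 2) = R at *
  field_simp
  have e : z ^ 2 = R ^ 2 - r ^ 2 := by linarith
  ring_nf
  simp only [e]
  ring

lemma hillDD_eq_secondForm (β c : ℝ) (hr : 0 < r) (z u w : ℝ) :
    hillDD β c u w r z = secondForm c (β + (1 - β) * (r / √(r ^ 2 + z ^ 2))) (1 / r)
      ((1 - β) * (r / √(r ^ 2 + z ^ 2)) ^ 3) (z / r)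
      (2 - 3 * (r / √(r ^ 2 + z ^ 2)) ^ 2) u (w - z / r * u) := by
  have hR : 0 < √(r ^ 2 + z ^ 2) := Real.sqrt_pos.2 (by positivity)
  have hR2 : √(r ^ 2 + z ^ 2) ^ 2 = r ^ 2 + z ^ 2 := Real.sq_sqrt (by positivity)
  unfold hillDD secondForm
  generalize √(r ^ 2 + z ^ 2) = R at *
  field_simp
  have e : z ^ 2 = R ^ 2 - r ^ 2 := by linarith
  ring_nf
  simp only [e]
  ring

end

section

variable {c q y μ w k : ℝ}

/-- The vector (u, w) is split into a multiple of the ray through (r, z) and a vertical remainder s.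
The coefficient of u² is then `radialCoeff` up to a positive factor. -/
lemma two_mul_profile_mul_secondForm_sub (u s : ℝ) :
    2 * profile c q y * secondForm c q y μ w k u s - firstForm c q y μ w u s ^ 2 =
      4 * y ^ 3 * (radialCoeff c q y * u ^ 2 +
        2 * (μ * w * (2 * profile c q y + y * (c * y - q))) * u * s +
        (μ * k * profile c q y - y * μ ^ 2 * w ^ 2) * s ^ 2) := by
  unfold secondForm firstForm radialCoeff; ring

/-- The determinant is divisible by the potential, so its sign over {U > 0} is that of a simpler
expression that also makes sense on {U = 0}. -/
lemma radialCoeff_mul_sub_sq :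
    radialCoeff c q y * (μ * k * profile c q y - y * μ ^ 2 * w ^ 2) -
      (μ * w * (2 * profile c q y + y * (c * y - q))) ^ 2 =
      μ * profile c q y * detCoeff c q y k (μ * w ^ 2) := by
  unfold detCoeff radialCoeff profile; ring

lemma quadratic_neg {P B C u s : ℝ} (hP : P < 0) (hdet : 0 < P * C - B ^ 2)
    (hus : u ≠ 0 ∨ s ≠ 0) : P * u ^ 2 + 2 * B * u * s + C * s ^ 2 < 0 := by
  have h1 : 0 < P * (P * u ^ 2 + 2 * B * u * s + C * s ^ 2) := by
    have e : P * (P * u ^ 2 + 2 * B * u * s + C * s ^ 2) =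
        (P * u + B * s) ^ 2 + (P * C - B ^ 2) * s ^ 2 := by ring
    rw [e]
    by_cases hs : s = 0
    · have hu : u ≠ 0 := hus.resolve_right (not_not.2 hs)
      subst hs
      have : 0 < (P * u) ^ 2 := by have := mul_ne_zero hP.ne hu; positivity
      simpa using this
    · have : 0 < (P * C - B ^ 2) * s ^ 2 := by positivity
      positivity
  by_contra! h
  nlinarith

lemma exists_quadratic_nonneg {P B C : ℝ} (hdet : P * C - B ^ 2 ≤ 0) :
    ∃ u s, (u ≠ 0 ∨ s ≠ 0) ∧ 0 ≤ P * u ^ 2 + 2 * B * u * s + C * s ^ 2 := by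
  rcases le_or_gt 0 P with hP | hP
  · exact ⟨1, 0, by simp, by simpa using hP⟩
  · refine ⟨-B, P, Or.inr hP.ne, ?_⟩
    have := mul_nonneg_of_nonpos_of_nonpos hP.le hdet
    linarith

lemma exists_quadratic_pos {P B C : ℝ} (hdet : P * C - B ^ 2 < 0) :
    ∃ u s, 0 < P * u ^ 2 + 2 * B * u * s + C * s ^ 2 := by
  rcases lt_trichotomy 0 P with hP | hP | hP
  · exact ⟨1, 0, by simpa using hP⟩
  · subst hP
    have hB : B ≠ 0 := by rintro rfl; simp at hdet
    refine ⟨(1 - C) / (2 * B), 1, ?_⟩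
    have e : 2 * B * ((1 - C) / (2 * B)) = 1 - C := mul_div_cancel₀ _ (by positivity)
    rw [e]
    linarith
  · refine ⟨-B, P, ?_⟩
    have := mul_pos_of_neg_of_neg hP hdet
    linarith

/-- Positivity of the curvature coefficients implies that the second derivative is positive on
tangent vectors. -/
lemma secondForm_lt {p₀ p₁ a₀ a₁ u s : ℝ} (hy : 0 < y) (hμ : 0 < μ) (hq : 0 < q)
    (hw : w = 0 → c < q ^ 2)
    (hU : 0 ≤ profile c q y) (hP : 0 < profile c q y → radialCoeff c q y < 0)
    (hD : 0 < detCoeff c q y k (μ * w ^ 2)) (hp : p₀ ^ 2 + p₁ ^ 2 = 2 * profile c q y)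
    (ht : p₀ * a₀ + p₁ * a₁ = firstForm c q y μ w u s)
    (hv : (a₀ ≠ 0 ∨ a₁ ≠ 0) ∨ (u ≠ 0 ∨ s ≠ 0)) :
    secondForm c q y μ w k u s < a₀ ^ 2 + a₁ ^ 2 := by
  by_cases hus : u ≠ 0 ∨ s ≠ 0
  swap
  · push Not at hus
    obtain ⟨rfl, rfl⟩ := hus
    have e : secondForm c q y μ w k 0 0 = 0 := by unfold secondForm; ring
    rw [e]
    rcases hv with (h | h) | (h | h)
    · positivity
    · positivity
    · exact absurd rfl h
    · exact absurd rfl h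
  rcases hU.eq_or_lt with hU0 | hU0
  -- On the boundary of the Hill region p = 0. Tangency becomes dU(u, s) = 0, and D²U must be
  -- negative on this kernel.
  · rw [← hU0, mul_zero] at hp
    have hp0 : p₀ = 0 := by nlinarith [sq_nonneg p₀, sq_nonneg p₁]
    have hp1 : p₁ = 0 := by nlinarith [sq_nonneg p₀, sq_nonneg p₁]
    rw [hp0, hp1] at ht
    have htan : u * (c * y - q) = μ * w * s := by
      unfold firstForm at ht
      have h2 : 2 * y ^ 2 * (u * (c * y - q) - μ * w * s) = 0 := by linarith
      have := (mul_eq_zero.1 h2).resolve_left (by positivity)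
      linarith
    suffices h : secondForm c q y μ w k u s < 0 by nlinarith [sq_nonneg a₀, sq_nonneg a₁]
    have hprof : c * y ^ 2 = 2 * q * y - 1 := by unfold profile at hU0; linarith
    unfold secondForm
    refine mul_neg_of_pos_of_neg (by positivity) ?_
    by_cases hcy : c * y - q = 0
    -- With w = 0, the relations U = 0 and cy = q force qy = 1 and c = q², which `hw` forbids.
    · have hw0 : w ≠ 0 := by
        intro hw0
        have h1 := hw hw0
        have h2 : q * y = 1 := by nlinarith
        have h3 : c = q ^ 2 := by
          have : c * (q * y) = q ^ 2 := by linear_combination q * hcy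
          rwa [h2, mul_one] at this
        linarith
      rw [hcy, mul_zero] at htan
      have hs : s = 0 := by
        have := (mul_eq_zero.1 htan.symm).resolve_left (mul_ne_zero hμ.ne' hw0)
        exact this
      have hu : u ≠ 0 := hus.resolve_right (not_not.2 hs)
      have h3 : 2 * q - 3 * c * y = -q := by linarith
      rw [hs, h3]
      have : 0 < u ^ 2 := by positivity
      nlinarith
    · have hs : s ≠ 0 := by
        rintro rfl
        rw [mul_zero] at htan
        have hu := (mul_eq_zero.1 htan).resolve_right hcy
        exact hus.elim (fun h => h hu) (fun h => h rfl)
      have hcy2 : 0 < (c * y - q) ^ 2 := by positivity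
      have hs2 : 0 < s ^ 2 := by positivity
      -- The tangency relation expresses u through s, and on {U = 0} the second derivative becomes a
      -- negative multiple of `detCoeff`.
      have key : (c * y - q) ^ 2 * (y * (u ^ 2 * (2 * q - 3 * c * y) + 4 * μ * w * u * s +
          μ * k * s ^ 2)) = -(s ^ 2 * μ * detCoeff c q y k (μ * w ^ 2)) := by
        have e1 : (c * y - q) ^ 2 * (u ^ 2 * (2 * q - 3 * c * y) + 4 * μ * w * u * s +
          μ * k * s ^ 2) = (u * (c * y - q)) ^ 2 * (2 * q - 3 * c * y) +
          4 * μ * w * s * (c * y - q) * (u * (c * y - q)) + (c * y - q) ^ 2 * μ * k * s ^ 2 := by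
          ring
        have e2 : detCoeff c q y k (μ * w ^ 2) = -(y * (c * y - q) ^ 2) * k + μ * w ^ 2 := by
          unfold detCoeff radialCoeff
          rw [← hU0]; ring
        rw [mul_left_comm, e1, htan, e2]
        linear_combination s ^ 2 * μ ^ 2 * w ^ 2 * hprof
      have hneg : (c * y - q) ^ 2 * (y * (u ^ 2 * (2 * q - 3 * c * y) + 4 * μ * w * u * s +
          μ * k * s ^ 2)) < 0 := by
        rw [key]
        have := mul_pos (mul_pos hs2 hμ) hD
        linarith
      have h5 := (pos_iff_neg_of_mul_neg hneg).1 hcy2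
      exact (pos_iff_neg_of_mul_neg h5).1 hy
  · have hdet := radialCoeff_mul_sub_sq (c := c) (q := q) (y := y) (μ := μ) (w := w) (k := k)
    have hneg := quadratic_neg (hP hU0) (by rw [hdet]; positivity) hus
    have h1 := two_mul_profile_mul_secondForm_sub (c := c) (q := q) (y := y) (μ := μ) (w := w)
      (k := k) u s
    have h2 := mul_neg_of_pos_of_neg (by positivity : 0 < 4 * y ^ 3) hneg
    -- Cauchy–Schwarz for p·a with |p|² = 2U.
    have h3 : firstForm c q y μ w u s ^ 2 ≤ 2 * profile c q y * (a₀ ^ 2 + a₁ ^ 2) := by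
      rw [← ht, ← hp]
      nlinarith [sq_nonneg (p₀ * a₁ - p₁ * a₀)]
    have h4 : 2 * profile c q y * secondForm c q y μ w k u s <
        2 * profile c q y * (a₀ ^ 2 + a₁ ^ 2) := by linarith
    exact lt_of_mul_lt_mul_left h4 (by positivity)

lemma exists_degenerate_direction (hy : 0 < y) (hμ : 0 < μ) (hU : 0 < profile c q y)
    (hD : detCoeff c q y k (μ * w ^ 2) ≤ 0) : ∃ u s, (u ≠ 0 ∨ s ≠ 0) ∧
      firstForm c q y μ w u s ^ 2 ≤ 2 * profile c q y * secondForm c q y μ w k u s := by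
  have hdet := radialCoeff_mul_sub_sq (c := c) (q := q) (y := y) (μ := μ) (w := w) (k := k)
  obtain ⟨u, s, hus, hn⟩ := exists_quadratic_nonneg
    (hdet.trans_le (mul_nonpos_of_nonneg_of_nonpos (by positivity) hD))
  refine ⟨u, s, hus, ?_⟩
  rw [← sub_nonneg, two_mul_profile_mul_secondForm_sub]
  exact mul_nonneg (by positivity) hn

lemma exists_negative_direction (hy : 0 < y) (hμ : 0 < μ) (hU : 0 < profile c q y)
    (hD : detCoeff c q y k (μ * w ^ 2) < 0) : ∃ u s,
      firstForm c q y μ w u s ^ 2 < 2 * profile c q y * secondForm c q y μ w k u s := by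
  have hdet := radialCoeff_mul_sub_sq (c := c) (q := q) (y := y) (μ := μ) (w := w) (k := k)
  obtain ⟨u, s, hn⟩ := exists_quadratic_pos
    (hdet.trans_lt (mul_neg_of_pos_of_neg (by positivity) hD))
  refine ⟨u, s, ?_⟩
  rw [← sub_pos, two_mul_profile_mul_secondForm_sub]
  exact mul_pos (by positivity) hn

end

/-! ### The coefficients at a given height -/

lemma mul_profile_eq {c q y : ℝ} (hq : 0 < q) :
    c / q ^ 2 * profile c q y = (1 - c / q ^ 2) - (1 - c * y / q) ^ 2 := by
  unfold profile; field_simp; ring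

lemma mul_radialCoeff_eq {c q y : ℝ} (hq : 0 < q) :
    c / q ^ 2 * radialCoeff c q y = -q * ((1 - c / q ^ 2) -
      3 * (1 - c / q ^ 2) * (1 - c * y / q) + 2 * (1 - c * y / q) ^ 3) := by
  unfold radialCoeff profile; field_simp; ring

/-- Here n = (1 - β)h(1 - h²) and k = 2 - 3h². Their dependence on β and h is absorbed in ρ and a,
so a one-parameter family of cubics in τ decides the curvature. -/
lemma mul_detCoeff_eq {c q y k n ρ a : ℝ} (hq : 0 < q) (hn : n = ρ * ((2 - a) ^ 2 * (2 + a)))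
    (hk : q * k = ρ * (2 * a * critDen a)) :
    c / q ^ 2 * detCoeff c q y k n = ρ * critForm a (1 - c / q ^ 2) (1 - c * y / q) := by
  have e : c / q ^ 2 * detCoeff c q y k n = (c / q ^ 2 * radialCoeff c q y) * k +
      n * (c / q ^ 2 - 3 * (c / q ^ 2 * profile c q y)) := by unfold detCoeff; ring
  rw [e, mul_radialCoeff_eq hq, mul_profile_eq hq, hn, critForm]
  linear_combination -((1 - c / q ^ 2) -
      3 * (1 - c / q ^ 2) * (1 - c * y / q) + 2 * (1 - c * y / q) ^ 3) * hk

/-- The critical point t = u = √(l/2) gives the value 2u²(1 - 2u), positive exactly for l < 1/2; the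
rest is (t - u)² times a factor that is nonnegative on t² ≤ l. -/
lemma cubic_pos {l t : ℝ} (h0 : 0 < l) (h1 : l < 1 / 2) (ht : t ^ 2 ≤ l) :
    0 < l - 3 * l * t + 2 * t ^ 3 := by
  have hu : 0 < √(l / 2) := Real.sqrt_pos.2 (by linarith)
  have hu2 : √(l / 2) ^ 2 = l / 2 := Real.sq_sqrt (by linarith)
  set u := √(l / 2)
  have hl : l = 2 * u ^ 2 := by linarith
  have h2 : u < 1 / 2 := by nlinarith
  have h3 : 0 ≤ t + 2 * u := by
    have : -(2 * u) ≤ t := (abs_le_of_sq_le_sq' (by nlinarith) (by positivity)).1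
    linarith
  have e : l - 3 * l * t + 2 * t ^ 3 = 2 * (u ^ 2 * (1 - 2 * u) + (t - u) ^ 2 * (t + 2 * u)) := by
    rw [hl]; ring
  rw [e]
  have : 0 < u ^ 2 * (1 - 2 * u) := mul_pos (by positivity) (by linarith)
  have := mul_nonneg (sq_nonneg (t - u)) h3
  linarith

/-! ### The sign of the curvature coefficients -/

section

variable {β c : ℝ}

lemma coeffs_of_critBound_sq_lt (h0 : 0 ≤ β) (h1 : β < 1) (hc1 : c < 1)
    (hb : critBound β ^ 2 < c) {h : ℝ} (hh0 : 0 < h) (hh1 : h ≤ 1) {y : ℝ}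
    (hU : 0 ≤ profile c (β + (1 - β) * h) y) :
    0 < detCoeff c (β + (1 - β) * h) y (2 - 3 * h ^ 2) ((1 - β) * h * (1 - h ^ 2)) ∧
      (0 < profile c (β + (1 - β) * h) y → radialCoeff c (β + (1 - β) * h) y < 0) := by
  have hq := height_pos h0 h1.le hh0
  have hq1 := height_le_one h1.le hh1
  obtain ⟨a, ha⟩ := exists_mem_critSet h0 h1.le hh0.le hh1
  obtain ⟨ρ, hρ, e1, e2⟩ := exists_scale_of_mem_critSet h0 h1 ha hh0
  have hle := le_critBound ha
  rw [critValue] at hle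
  have hX : 0 ≤ 1 - h ^ 2 := by nlinarith
  have hcase : a = -2 → h = 1 := by
    rintro rfl
    rw [add_neg_cancel, mul_zero, mul_zero] at e1
    have : 1 - h ^ 2 = 0 :=
      (mul_eq_zero.1 e1).resolve_left (mul_pos (by linarith) hh0).ne'
    nlinarith
  set q := β + (1 - β) * h with hq_def
  have hc0 : 0 < c := lt_trans (by have := critBound_pos β; positivity) hb
  have hκ : 0 < c / q ^ 2 := by positivity
  have hl : 1 - c / q ^ 2 < critLambda a := by
    have h2 : q ^ 2 * critFactor a ^ 2 < c := by
      refine lt_of_le_of_lt ?_ hb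
      rw [← mul_pow]
      exact pow_le_pow_left₀ (mul_nonneg hq.le (critFactor_pos a).le) hle 2
    have h3 : critFactor a ^ 2 < c / q ^ 2 := by rw [lt_div_iff₀ (by positivity)]; linarith
    have := one_sub_critLambda a
    linarith
  have hτ : (1 - c * y / q) ^ 2 ≤ 1 - c / q ^ 2 := by
    have := mul_nonneg hκ.le hU
    rw [mul_profile_eq hq] at this
    linarith
  -- From q ≤ 1 and c > `critBound`² ≥ 1/2.
  have hhalf : 1 - c / q ^ 2 < 1 / 2 := by
    have h2 := half_le_critBound_sq β
    have h3 : c ≤ c / q ^ 2 := by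
      rw [le_div_iff₀ (by positivity)]
      have : q ^ 2 ≤ 1 := by nlinarith
      nlinarith
    linarith
  have hP : 0 < 1 - c / q ^ 2 → radialCoeff c q y < 0 := by
    intro hpos
    have h2 := mul_radialCoeff_eq (c := c) (y := y) hq
    have h3 := mul_pos hq (cubic_pos hpos hhalf hτ)
    have h4 : c / q ^ 2 * radialCoeff c q y < 0 := by rw [h2]; linarith
    exact (pos_iff_neg_of_mul_neg h4).1 hκ
  refine ⟨?_, fun hUpos => hP ?_⟩
  · have h2 := mul_detCoeff_eq (c := c) (y := y) hq e1 e2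
    refine pos_of_mul_pos_right (b := detCoeff c q y _ _) ?_ hκ.le
    rw [h2]
    apply mul_pos hρ
    -- The value a = -2 occurs only at h = 1, where the form is 64 times the cubic of `cubic_pos`.
    rcases (ha.1.2.1 : -2 ≤ a).eq_or_lt with rfl | ha'
    · have hh := hcase rfl
      have hq' : q = 1 := by rw [hq_def, hh]; ring
      rw [hq'] at hhalf hτ ⊢
      have hpos : 0 < 1 - c / 1 ^ 2 := by norm_num; exact hc1
      have := cubic_pos hpos hhalf hτ
      have e : ∀ l t, critForm (-2) l t = 64 * (l - 3 * l * t + 2 * t ^ 3) := by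
        intro l t; unfold critForm critDen; ring
      rw [e]
      linarith
    · exact critForm_pos ha' ha.1.2.2 hτ hl
  · have := mul_pos hκ hUpos
    rw [mul_profile_eq hq] at this
    nlinarith [sq_nonneg (1 - c * y / q)]

/-- At a pair (h, a) attaining the supremum, y is chosen so that τ = `critTau a`. There the form
equals 32(`critLambda a` - λ), and c ≤ `critBound`² means λ ≥ `critLambda a`. -/
lemma exists_degenerate_point (h0 : 0 ≤ β) (h1 : β < 1) (hc0 : 0 < c)
    (hb : c ≤ critBound β ^ 2) : ∃ h y, 0 < h ∧ h ≤ 1 ∧ 0 < y ∧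
    0 < profile c (β + (1 - β) * h) y ∧
    detCoeff c (β + (1 - β) * h) y (2 - 3 * h ^ 2) ((1 - β) * h * (1 - h ^ 2)) ≤ 0 ∧
    (c < critBound β ^ 2 →
      detCoeff c (β + (1 - β) * h) y (2 - 3 * h ^ 2) ((1 - β) * h * (1 - h ^ 2)) < 0) := by
  obtain ⟨h, a, ha, he⟩ := exists_eq_critBound β
  have hh0 : 0 < h := height_pos_of_eq_critBound h0 h1 ha.1.1.1 he
  have hh1 : h ≤ 1 := ha.1.1.2
  obtain ⟨ρ, hρ, e1, e2⟩ := exists_scale_of_mem_critSet h0 h1 ha hh0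
  have hq := height_pos h0 h1.le hh0
  have ha2 : a < 2 := by
    refine lt_of_le_of_ne ha.1.2.2 ?_
    rintro rfl
    rw [sub_self, zero_pow two_ne_zero, zero_mul, mul_zero] at e1
    have h3 : 1 - h ^ 2 = 0 := (mul_eq_zero.1 e1).resolve_left (mul_pos (by linarith) hh0).ne'
    have h4 : 0 < ρ * (2 * 2 * critDen 2) := by have := critDen_pos 2; positivity
    have h5 : 2 - 3 * h ^ 2 = -1 := by linarith
    rw [← e2, h5] at h4
    linarith
  set q := β + (1 - β) * h with hq_def
  have hκ : 0 < c / q ^ 2 := by positivity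
  have hτ := critTau_sq_lt ha2
  have hl1 : critLambda a < 1 := by
    have := one_sub_critLambda a
    have := pow_pos (critFactor_pos a) 2
    linarith
  have hτ1 : critTau a < 1 := by nlinarith
  have hcl : c / q ^ 2 ≤ 1 - critLambda a := by
    rw [one_sub_critLambda, div_le_iff₀ (by positivity), ← mul_pow, mul_comm, ← he]
    exact hb
  have hτy : 1 - c * (q * (1 - critTau a) / c) / q = critTau a := by
    field_simp; ring
  have hdet : c / q ^ 2 * detCoeff c q (q * (1 - critTau a) / c) (2 - 3 * h ^ 2)
      ((1 - β) * h * (1 - h ^ 2)) = ρ * (32 * (critLambda a - (1 - c / q ^ 2))) := by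
    rw [mul_detCoeff_eq hq e1 e2, hτy, critForm_critTau]
  refine ⟨h, q * (1 - critTau a) / c, hh0, hh1,
    div_pos (mul_pos hq (by linarith)) hc0, ?_, ?_, ?_⟩
  · refine pos_of_mul_pos_right ?_ hκ.le
    rw [mul_profile_eq hq, hτy]
    linarith
  · refine nonpos_of_mul_nonpos_right ?_ hκ
    rw [hdet]
    exact mul_nonpos_of_nonneg_of_nonpos hρ.le (by linarith)
  · intro hlt
    have hcl' : c / q ^ 2 < 1 - critLambda a := by
      rw [one_sub_critLambda, div_lt_iff₀ (by positivity), ← mul_pow, mul_comm, ← he]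
      exact hlt
    have h3 : c / q ^ 2 * detCoeff c q (q * (1 - critTau a) / c) (2 - 3 * h ^ 2)
        ((1 - β) * h * (1 - h ^ 2)) < 0 := by
      rw [hdet]
      exact mul_neg_of_pos_of_neg hρ (by linarith)
    exact (pos_iff_neg_of_mul_neg h3).1 hκ

end

/-! ### The Hamiltonian in rescaled coordinates -/

lemma betaParam_pos {α : ℝ} (hα : 0 < α) : 0 < betaParam α := by
  unfold betaParam; positivity

lemma betaParam_lt_one {α : ℝ} (hα : 0 < α) : betaParam α < 1 := by
  unfold betaParam
  exact inv_lt_one_of_one_lt₀ (by have : 0 < 4 * α⁻¹ := by positivity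
                                  linarith)

/-- The parameter `c = 1 - ε²`. -/
def angParam (α ϖ : ℝ) : ℝ := 2 * ϖ ^ 2 * betaParam α ^ 2

/-- The radial coordinate in units where the Hill region depends on `(β, c)` only. -/
def scaledR (α : ℝ) (x : PhaseSpace) : ℝ := 2 * betaParam α * x 2

/-- The vertical coordinate in units where the Hill region depends on `(β, c)` only. -/
def scaledZ (α : ℝ) (x : PhaseSpace) : ℝ := 2 * betaParam α * √(1 + 2 * α) * x 3

section

variable {α : ℝ}

lemma isoHamiltonian_eq (hα : 0 < α) (ϖ : ℝ) {x : PhaseSpace} (hx : 0 < x 2) :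
    isoHamiltonian α ϖ x = (x 0 ^ 2 + x 1 ^ 2) / 2 - 1 -
      hillFn (betaParam α) (angParam α ϖ) (scaledR α x) (scaledZ α x) := by
  have hβ := betaParam_pos hα
  have hα' : 4 * α⁻¹ = (1 - betaParam α) / betaParam α := by
    have : (betaParam α)⁻¹ = 1 + 4 * α⁻¹ := by unfold betaParam; rw [inv_inv]
    rw [sub_div, one_div, this, div_self hβ.ne']; ring
  have hs : √((2 * betaParam α * x 2) ^ 2 + (2 * betaParam α * √(1 + 2 * α) * x 3) ^ 2) =
      2 * betaParam α * √((x 2) ^ 2 + (1 + 2 * α) * (x 3) ^ 2) := by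
    rw [mul_pow _ (x 3), mul_pow _ √(1 + 2 * α), Real.sq_sqrt (by positivity),
      show (2 * betaParam α * x 2) ^ 2 + (2 * betaParam α) ^ 2 * (1 + 2 * α) * (x 3) ^ 2 =
        (2 * betaParam α) ^ 2 * ((x 2) ^ 2 + (1 + 2 * α) * (x 3) ^ 2) by ring,
      Real.sqrt_mul (sq_nonneg _), Real.sqrt_sq (by positivity)]
  have hR : 0 < √((x 2) ^ 2 + (1 + 2 * α) * (x 3) ^ 2) := Real.sqrt_pos.2 (by positivity)
  unfold isoHamiltonian isoPotential hillFn angParam scaledR scaledZ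
  rw [hs, hα']
  field_simp
  ring

lemma isOpen_isoDomain : IsOpen isoDomain := by
  have : Continuous fun x : PhaseSpace => x 2 := by fun_prop
  exact isOpen_lt continuous_const this

lemma convex_isoDomain : Convex ℝ isoDomain := by
  intro x hx y hy a b ha hb hab
  simp only [isoDomain, Set.mem_ofPred_eq, PiLp.add_apply, PiLp.smul_apply, smul_eq_mul] at *
  rcases ha.eq_or_lt with rfl | ha
  · have : b = 1 := by linarith
    subst this; simpa using hy
  · have := mul_pos ha hx
    have := mul_nonneg hb hy.le
    linarith

lemma contDiffAt_isoHamiltonian (hα : 0 < α) (ϖ : ℝ) {x : PhaseSpace} (hx : x ∈ isoDomain) :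
    ContDiffAt ℝ 2 (isoHamiltonian α ϖ) x := by
  have hx2 : 0 < x 2 := hx
  have hc : ∀ i : Fin 4, ContDiffAt ℝ 2 (fun x : PhaseSpace => x i) x := fun i => by fun_prop
  have hR : 0 < (x 2) ^ 2 + (1 + 2 * α) * (x 3) ^ 2 := by positivity
  unfold isoHamiltonian isoPotential
  refine ContDiffAt.add ?_ (ContDiffAt.sub (ContDiffAt.sub ?_ ?_) ?_)
  · exact (((hc 0).pow 2).add ((hc 1).pow 2)).div_const 2
  · exact contDiffAt_const.div (contDiffAt_const.mul ((hc 2).pow 2)) (by positivity)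
  · exact contDiffAt_const.div (hc 2) hx2.ne'
  · exact contDiffAt_const.div ((((hc 2).pow 2).add (contDiffAt_const.mul ((hc 3).pow 2))).sqrt
      hR.ne') (Real.sqrt_pos.2 hR).ne'

lemma hasDerivAt_isoHamiltonian_line (hα : 0 < α) (ϖ : ℝ) (x v : PhaseSpace) {t : ℝ}
    (ht : 0 < x 2 + t * v 2) :
    HasDerivAt (fun t : ℝ => isoHamiltonian α ϖ (x + t • v))
      ((x 0 + t * v 0) * v 0 + (x 1 + t * v 1) * v 1 -
        hillD (betaParam α) (angParam α ϖ) (scaledR α v) (scaledZ α v)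
          (scaledR α x + t * scaledR α v) (scaledZ α x + t * scaledZ α v)) t := by
  have hβ := betaParam_pos hα
  have hev : ∀ᶠ s : ℝ in 𝓝 t, 0 < x 2 + s * v 2 := by
    have : Continuous fun s : ℝ => x 2 + s * v 2 := by fun_prop
    exact this.continuousAt.eventually (lt_mem_nhds ht)
  have heq : (fun t : ℝ => isoHamiltonian α ϖ (x + t • v)) =ᶠ[𝓝 t] fun t =>
      ((x 0 + t * v 0) ^ 2 + (x 1 + t * v 1) ^ 2) / 2 - 1 -
        hillFn (betaParam α) (angParam α ϖ) (scaledR α x + t * scaledR α v)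
          (scaledZ α x + t * scaledZ α v) := by
    filter_upwards [hev] with s hs
    rw [isoHamiltonian_eq hα ϖ (by simpa using hs)]
    congr 2 <;> simp [scaledR, scaledZ] <;> ring
  refine HasDerivAt.congr_of_eventuallyEq ?_ heq
  have hr : 0 < scaledR α x + t * scaledR α v := by
    have : scaledR α x + t * scaledR α v = 2 * betaParam α * (x 2 + t * v 2) := by
      unfold scaledR; ring
    rw [this]; positivity
  have h1 := (((hasDerivAt_affine (x 0) (v 0) t).pow 2).add
    ((hasDerivAt_affine (x 1) (v 1) t).pow 2)).div_const 2
  refine ((h1.sub_const 1).sub (hasDerivAt_hillFn_line (betaParam α) (angParam α ϖ) hr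
    (scaledZ α x) (scaledZ α v))).congr_deriv ?_
  norm_num
  ring

lemma fderiv_isoHamiltonian (hα : 0 < α) (ϖ : ℝ) {x : PhaseSpace} (hx : x ∈ isoDomain)
    (v : PhaseSpace) :
    fderiv ℝ (isoHamiltonian α ϖ) x v = x 0 * v 0 + x 1 * v 1 -
      hillD (betaParam α) (angParam α ϖ) (scaledR α v) (scaledZ α v)
          (scaledR α x) (scaledZ α x) := by
  rw [← deriv_line (contDiffAt_isoHamiltonian hα ϖ hx)]
  have h := hasDerivAt_isoHamiltonian_line hα ϖ x v (t := 0) (by simpa using (show 0 < x 2 from hx))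
  simpa using h.deriv

lemma fderiv_fderiv_isoHamiltonian (hα : 0 < α) (ϖ : ℝ) {x : PhaseSpace} (hx : x ∈ isoDomain)
    (v : PhaseSpace) :
    fderiv ℝ (fderiv ℝ (isoHamiltonian α ϖ)) x v v = v 0 ^ 2 + v 1 ^ 2 -
      hillDD (betaParam α) (angParam α ϖ) (scaledR α v) (scaledZ α v)
          (scaledR α x) (scaledZ α x) := by
  rw [← deriv_deriv_line (contDiffAt_isoHamiltonian hα ϖ hx)]
  have hev : ∀ᶠ s : ℝ in 𝓝 0, 0 < x 2 + s * v 2 := by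
    have h1 : Continuous fun s : ℝ => x 2 + s * v 2 := by fun_prop
    exact h1.continuousAt.eventually (lt_mem_nhds (by simpa using (show 0 < x 2 from hx)))
  have heq : deriv (fun t : ℝ => isoHamiltonian α ϖ (x + t • v)) =ᶠ[𝓝 0] fun t =>
      (x 0 + t * v 0) * v 0 + (x 1 + t * v 1) * v 1 -
        hillD (betaParam α) (angParam α ϖ) (scaledR α v) (scaledZ α v)
          (scaledR α x + t * scaledR α v) (scaledZ α x + t * scaledZ α v) :=
    hev.mono fun s hs => (hasDerivAt_isoHamiltonian_line hα ϖ x v hs).deriv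
  rw [heq.deriv_eq]
  have hr : 0 < scaledR α x + 0 * scaledR α v := by
    have := betaParam_pos hα
    have hx2 : 0 < x 2 := hx
    rw [zero_mul, add_zero, scaledR]; positivity
  have h1 := ((hasDerivAt_affine (x 0) (v 0) 0).mul_const (v 0)).add
    ((hasDerivAt_affine (x 1) (v 1) 0).mul_const (v 1))
  have h2 := (h1.sub (hasDerivAt_hillD_line (betaParam α) (angParam α ϖ) hr
    (scaledZ α x) (scaledZ α v))).deriv
  refine Eq.trans h2 ?_
  simp only [zero_mul, add_zero]
  ring

end

/-! ### Curvature of the energy surface -/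

section

variable {α ϖ : ℝ}

lemma scaledR_pos (hα : 0 < α) {x : PhaseSpace} (hx : x ∈ isoDomain) : 0 < scaledR α x :=
  mul_pos (by have := betaParam_pos hα; positivity) hx

lemma ratio_mem {r : ℝ} (hr : 0 < r) (z : ℝ) :
    0 < r / √(r ^ 2 + z ^ 2) ∧ r / √(r ^ 2 + z ^ 2) ≤ 1 := by
  have hR : 0 < √(r ^ 2 + z ^ 2) := Real.sqrt_pos.2 (by positivity)
  refine ⟨by positivity, ?_⟩
  rw [div_le_one hR]
  exact Real.le_sqrt_of_sq_le (by nlinarith [sq_nonneg z])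

lemma ratio_cube_mul {r : ℝ} (hr : 0 < r) (z : ℝ) (β : ℝ) :
    (1 - β) * (r / √(r ^ 2 + z ^ 2)) ^ 3 * (z / r) ^ 2 =
      (1 - β) * (r / √(r ^ 2 + z ^ 2)) * (1 - (r / √(r ^ 2 + z ^ 2)) ^ 2) := by
  have hR : 0 < √(r ^ 2 + z ^ 2) := Real.sqrt_pos.2 (by positivity)
  have hR2 : √(r ^ 2 + z ^ 2) ^ 2 = r ^ 2 + z ^ 2 := Real.sq_sqrt (by positivity)
  generalize √(r ^ 2 + z ^ 2) = R at *
  have e : z ^ 2 = R ^ 2 - r ^ 2 := by linarith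
  field_simp
  rw [e]

lemma ratio_zero {r : ℝ} (hr : 0 < r) : r / √(r ^ 2 + 0 ^ 2) = 1 := by
  rw [zero_pow two_ne_zero, add_zero, Real.sqrt_sq hr.le, div_self hr.ne']

lemma pos_curvature (hα : 0 < α) (hc1 : angParam α ϖ < 1)
    (hb : critBound (betaParam α) ^ 2 < angParam α ϖ) {x : PhaseSpace} (hx : x ∈ isoDomain)
    (hH : isoHamiltonian α ϖ x = -1) {v : PhaseSpace} (hv : v ≠ 0)
    (ht : fderiv ℝ (isoHamiltonian α ϖ) x v = 0) :
    0 < fderiv ℝ (fderiv ℝ (isoHamiltonian α ϖ)) x v v := by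
  have hβ := betaParam_pos hα
  have hβ1 := betaParam_lt_one hα
  have hr := scaledR_pos hα hx
  have hs : 0 < √(1 + 2 * α) := Real.sqrt_pos.2 (by positivity)
  rw [fderiv_isoHamiltonian hα ϖ hx, hillD_eq_firstForm _ _ hr] at ht
  rw [fderiv_fderiv_isoHamiltonian hα ϖ hx, hillDD_eq_secondForm _ _ hr, sub_pos]
  rw [isoHamiltonian_eq hα ϖ hx, hillFn_eq_profile _ _ hr] at hH
  obtain ⟨hh0, hh1⟩ := ratio_mem hr (scaledZ α x)
  have hcube := ratio_cube_mul hr (scaledZ α x) (betaParam α)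
  have hw0 : scaledZ α x / scaledR α x = 0 →
      scaledR α x / √(scaledR α x ^ 2 + scaledZ α x ^ 2) = 1 := by
    intro h
    have hz : scaledZ α x = 0 := by simpa [hr.ne'] using h
    rw [hz, ratio_zero hr]
  set h := scaledR α x / √(scaledR α x ^ 2 + scaledZ α x ^ 2)
  have hU : 0 ≤ profile (angParam α ϖ) (betaParam α + (1 - betaParam α) * h) (1 / scaledR α x) := by
    nlinarith [sq_nonneg (x 0), sq_nonneg (x 1)]
  obtain ⟨hD, hP⟩ := coeffs_of_critBound_sq_lt hβ.le hβ1 hc1 hb hh0 hh1 hU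
  refine secondForm_lt (p₀ := x 0) (p₁ := x 1) (by positivity)
    (mul_pos (by linarith) (by positivity)) (height_pos hβ.le hβ1.le hh0) ?_ hU hP
    (by rwa [hcube]) (by linarith) (by linarith) ?_
  · intro hw
    rw [hw0 hw]
    ring_nf
    exact hc1
  · by_contra! hcon
    obtain ⟨⟨h1, h2⟩, h3, h4⟩ := hcon
    rw [h3, mul_zero, sub_zero] at h4
    apply hv
    have h5 : v 2 = 0 := by simpa [scaledR, hβ.ne'] using h3
    have h6 : v 3 = 0 := by simpa [scaledZ, hβ.ne', hs.ne'] using h4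
    ext i
    fin_cases i
    exacts [h1, h2, h5, h6]

/-- A critical point on the surface has p = 0, cy = q and z = 0, hence q = 1; then U = 0 forces y =
1 and c = 1, which is excluded. -/
lemma fderiv_ne_zero (hα : 0 < α) (hc1 : angParam α ϖ < 1) {x : PhaseSpace} (hx : x ∈ isoDomain)
    (hH : isoHamiltonian α ϖ x = -1) : fderiv ℝ (isoHamiltonian α ϖ) x ≠ 0 := by
  intro h0
  have hβ := betaParam_pos hα
  have hβ1 := betaParam_lt_one hα
  have hr := scaledR_pos hα hx
  have hx2 : 0 < x 2 := hx
  have hs : 0 < √(1 + 2 * α) := Real.sqrt_pos.2 (by positivity)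
  have hall : ∀ v : PhaseSpace, x 0 * v 0 + x 1 * v 1 =
      firstForm (angParam α ϖ) (betaParam α + (1 - betaParam α) *
        (scaledR α x / √(scaledR α x ^ 2 + scaledZ α x ^ 2))) (1 / scaledR α x)
        ((1 - betaParam α) * (scaledR α x / √(scaledR α x ^ 2 + scaledZ α x ^ 2)) ^ 3)
        (scaledZ α x / scaledR α x) (scaledR α v)
        (scaledZ α v - scaledZ α x / scaledR α x * scaledR α v) := by
    intro v
    rw [← hillD_eq_firstForm _ _ hr, ← sub_eq_zero, ← fderiv_isoHamiltonian hα ϖ hx, h0]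
    rfl
  rw [isoHamiltonian_eq hα ϖ hx, hillFn_eq_profile _ _ hr] at hH
  have hp : x 0 * x 0 + x 1 * x 1 = 0 := by
    have e1 : scaledR α !₂[x 0, x 1, 0, 0] = 0 := by simp [scaledR]
    have e2 : scaledZ α !₂[x 0, x 1, 0, 0] = 0 := by simp [scaledZ]
    have := hall !₂[x 0, x 1, 0, 0]
    rw [e1, e2] at this
    simpa [firstForm] using this
  have hrad := hall !₂[0, 0, x 2, x 3]
  have hang := hall !₂[0, 0, 0, 1]
  have hz0 : scaledZ α x / scaledR α x = 0 →
      scaledR α x / √(scaledR α x ^ 2 + scaledZ α x ^ 2) = 1 := by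
    intro hz
    have hz : scaledZ α x = 0 := by simpa [hr.ne'] using hz
    rw [hz, ratio_zero hr]
  obtain ⟨hh0, -⟩ := ratio_mem hr (scaledZ α x)
  set h := scaledR α x / √(scaledR α x ^ 2 + scaledZ α x ^ 2)
  have hrad' : angParam α ϖ * (1 / scaledR α x) - (betaParam α + (1 - betaParam α) * h) = 0 := by
    have eR : scaledR α !₂[0, 0, x 2, x 3] = scaledR α x := by simp [scaledR]
    have eZ : scaledZ α !₂[0, 0, x 2, x 3] = scaledZ α x := by simp [scaledZ]
    rw [eR, eZ, div_mul_cancel₀ _ hr.ne', sub_self, firstForm, mul_zero, sub_zero] at hrad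
    have h2 : 2 * (1 / scaledR α x) ^ 2 * scaledR α x * (angParam α ϖ * (1 / scaledR α x) -
        (betaParam α + (1 - betaParam α) * h)) = 0 := by
      rw [mul_assoc, ← hrad]; simp
    exact (mul_eq_zero.1 h2).resolve_left (by positivity)
  have hz : scaledZ α x / scaledR α x = 0 := by
    have eR : scaledR α !₂[0, 0, 0, 1] = 0 := by simp [scaledR]
    have eZ : scaledZ α !₂[0, 0, 0, 1] = 2 * betaParam α * √(1 + 2 * α) := by simp [scaledZ]
    rw [eR, eZ, firstForm, mul_zero, sub_zero, zero_mul, zero_sub] at hang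
    have h2 : 2 * (1 / scaledR α x) ^ 2 * ((1 - betaParam α) * h ^ 3) *
        (2 * betaParam α * √(1 + 2 * α)) * (scaledZ α x / scaledR α x) = 0 := by
      have h3 : (0 : ℝ) = 2 * (1 / scaledR α x) ^ 2 * -((1 - betaParam α) * h ^ 3 *
        (scaledZ α x / scaledR α x) * (2 * betaParam α * √(1 + 2 * α))) := by
        rw [← hang]; simp
      linarith
    have : 0 < 1 - betaParam α := by linarith
    exact (mul_eq_zero.1 h2).resolve_left (by positivity)
  rw [hz0 hz, mul_one, add_sub_cancel] at hrad' hH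
  have hy : 0 < 1 / scaledR α x := by positivity
  have hprof : profile (angParam α ϖ) 1 (1 / scaledR α x) = 0 := by linarith
  unfold profile at hprof
  have hy1 : 1 / scaledR α x = 1 := by
    linear_combination hprof + (1 / scaledR α x) * hrad'
  rw [hy1] at hrad'
  linarith

/-! ### The sublevel set -/

/-- The open set bounded by the energy surface. -/
def energyInterior (α ϖ : ℝ) : Set PhaseSpace := {x | x ∈ isoDomain ∧ isoHamiltonian α ϖ x < -1}

/-- The closed set bounded by the energy surface. -/
def energyBody (α ϖ : ℝ) : Set PhaseSpace := {x | x ∈ isoDomain ∧ isoHamiltonian α ϖ x ≤ -1}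

lemma isOpen_energyInterior (hα : 0 < α) : IsOpen (energyInterior α ϖ) := by
  have hcont : ContinuousOn (isoHamiltonian α ϖ) isoDomain := fun x hx =>
    (contDiffAt_isoHamiltonian hα ϖ hx).continuousAt.continuousWithinAt
  exact hcont.isOpen_inter_preimage isOpen_isoDomain isOpen_Iio

/-- A point on the symmetry axis in the energy interior. -/
def axisPoint (α ϖ : ℝ) : PhaseSpace := !₂[0, 0, angParam α ϖ / (2 * betaParam α), 0]

lemma hillFn_zero (β c : ℝ) {r : ℝ} (hr : 0 < r) :
    hillFn β c r 0 = -(r ^ 2 - 2 * r + c) / r ^ 2 := by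
  unfold hillFn
  rw [zero_pow two_ne_zero, add_zero, Real.sqrt_sq hr.le]
  field_simp
  ring

lemma hillFn_antitone {β c r z z' : ℝ} (hβ : β ≤ 1) (hr : 0 < r) (hz : z ^ 2 ≤ z' ^ 2) :
    hillFn β c r z' ≤ hillFn β c r z := by
  have hR : 0 < √(r ^ 2 + z ^ 2) := Real.sqrt_pos.2 (by positivity)
  unfold hillFn
  have : √(r ^ 2 + z ^ 2) ≤ √(r ^ 2 + z' ^ 2) := Real.sqrt_le_sqrt (by linarith)
  have := div_le_div_of_nonneg_left (by linarith : 0 ≤ 2 * (1 - β)) hR this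
  linarith

lemma hillFn_strictAnti {β c r z z' : ℝ} (hβ : β < 1) (hr : 0 < r) (hz : z ^ 2 < z' ^ 2) :
    hillFn β c r z' < hillFn β c r z := by
  have hR : 0 < √(r ^ 2 + z ^ 2) := Real.sqrt_pos.2 (by positivity)
  unfold hillFn
  have : √(r ^ 2 + z ^ 2) < √(r ^ 2 + z' ^ 2) := Real.sqrt_lt_sqrt (by positivity) (by linarith)
  have := div_lt_div_of_pos_left (by linarith : 0 < 2 * (1 - β)) hR this
  linarith

/-- The vector from `x` to its projection to the axis `{p = 0, z = 0}`. -/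
def toAxis (x : PhaseSpace) : PhaseSpace := !₂[-x 0, -x 1, 0, -x 3]

lemma toAxis_line_mem (x : PhaseSpace) (hx : x ∈ isoDomain) (s : ℝ) :
    x + s • toAxis x ∈ isoDomain := by
  have : 0 < x 2 := hx
  simpa [isoDomain, toAxis] using this

lemma isoHamiltonian_toAxis_le (hα : 0 < α) {x : PhaseSpace} (hx : x ∈ isoDomain) {s : ℝ}
    (hs : 0 ≤ s) (hs1 : s ≤ 1) :
    isoHamiltonian α ϖ (x + s • toAxis x) ≤ isoHamiltonian α ϖ x := by
  have hβ1 := betaParam_lt_one hα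
  have hr := scaledR_pos hα hx
  rw [isoHamiltonian_eq hα ϖ hx, isoHamiltonian_eq hα ϖ (toAxis_line_mem x hx s)]
  have e0 : (x + s • toAxis x) 0 = (1 - s) * x 0 := by simp [toAxis]; ring
  have e1 : (x + s • toAxis x) 1 = (1 - s) * x 1 := by simp [toAxis]; ring
  have e2 : scaledR α (x + s • toAxis x) = scaledR α x := by simp [toAxis, scaledR]
  have e3 : scaledZ α (x + s • toAxis x) = (1 - s) * scaledZ α x := by
    simp [toAxis, scaledZ]; ring
  have hsq : (1 - s) ^ 2 ≤ 1 := by nlinarith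
  have h1 := hillFn_antitone (c := angParam α ϖ) hβ1.le hr
    (show ((1 - s) * scaledZ α x) ^ 2 ≤ scaledZ α x ^ 2 by
      rw [mul_pow]; exact mul_le_of_le_one_left (sq_nonneg _) hsq)
  rw [e0, e1, e2, e3, mul_pow, mul_pow]
  have := mul_le_of_le_one_left (sq_nonneg (x 0)) hsq
  have := mul_le_of_le_one_left (sq_nonneg (x 1)) hsq
  linarith

lemma isoHamiltonian_toAxis_lt (hα : 0 < α) {x : PhaseSpace} (hx : x ∈ isoDomain) {s : ℝ}
    (hs : 0 < s) (hs1 : s ≤ 1) (hne : toAxis x ≠ 0) :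
    isoHamiltonian α ϖ (x + s • toAxis x) < isoHamiltonian α ϖ x := by
  have hβ := betaParam_pos hα
  have hβ1 := betaParam_lt_one hα
  have hr := scaledR_pos hα hx
  rw [isoHamiltonian_eq hα ϖ hx, isoHamiltonian_eq hα ϖ (toAxis_line_mem x hx s)]
  have e0 : (x + s • toAxis x) 0 = (1 - s) * x 0 := by simp [toAxis]; ring
  have e1 : (x + s • toAxis x) 1 = (1 - s) * x 1 := by simp [toAxis]; ring
  have e2 : scaledR α (x + s • toAxis x) = scaledR α x := by simp [toAxis, scaledR]
  have e3 : scaledZ α (x + s • toAxis x) = (1 - s) * scaledZ α x := by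
    simp [toAxis, scaledZ]; ring
  have hsq : (1 - s) ^ 2 < 1 := by nlinarith
  have h1 := hillFn_antitone (c := angParam α ϖ) hβ1.le hr
    (show ((1 - s) * scaledZ α x) ^ 2 ≤ scaledZ α x ^ 2 by
      rw [mul_pow]; exact mul_le_of_le_one_left (sq_nonneg _) hsq.le)
  rw [e0, e1, e2, e3, mul_pow, mul_pow]
  have h2 := mul_le_of_le_one_left (sq_nonneg (x 0)) hsq.le
  have h3 := mul_le_of_le_one_left (sq_nonneg (x 1)) hsq.le
  by_cases hp0 : x 0 = 0
  · by_cases hp1 : x 1 = 0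
    · have hz : x 3 ≠ 0 := by
        intro hz
        apply hne
        ext i
        fin_cases i <;> simp [toAxis, hp0, hp1, hz]
      have hz' : scaledZ α x ≠ 0 :=
        mul_ne_zero (by have : 0 < √(1 + 2 * α) := Real.sqrt_pos.2 (by positivity)
                        positivity) hz
      have h4 := hillFn_strictAnti (c := angParam α ϖ) hβ1 hr
        (show ((1 - s) * scaledZ α x) ^ 2 < scaledZ α x ^ 2 by
          rw [mul_pow]; exact mul_lt_of_lt_one_left (by positivity) hsq)
      linarith
    · have := mul_lt_of_lt_one_left (by positivity : 0 < x 1 ^ 2) hsq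
      linarith
  · have := mul_lt_of_lt_one_left (by positivity : 0 < x 0 ^ 2) hsq
    linarith

lemma scaledR_axisPoint (hα : 0 < α) : scaledR α (axisPoint α ϖ) = angParam α ϖ := by
  have := betaParam_pos hα
  simp only [scaledR, axisPoint]
  simp
  field_simp

lemma angParam_pos (hα : 0 < α) (hϖ : 0 < ϖ) : 0 < angParam α ϖ := by
  have := betaParam_pos hα
  unfold angParam; positivity

lemma axisPoint_mem_isoDomain (hα : 0 < α) (hϖ : 0 < ϖ) : axisPoint α ϖ ∈ isoDomain := by
  have := betaParam_pos hα
  have := angParam_pos hα hϖ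
  have : 0 < angParam α ϖ / (2 * betaParam α) := by positivity
  simpa [isoDomain, axisPoint] using this

/-- From a point on the axis the body contains the segment to `axisPoint`. -/
lemma axis_segment (hα : 0 < α) (hϖ : 0 < ϖ) (hc1 : angParam α ϖ < 1) {x : PhaseSpace}
    (hx : x ∈ energyBody α ϖ) (hax : toAxis x = 0) {s : ℝ} (hs : 0 < s) (hs1 : s ≤ 1) :
    x + s • (axisPoint α ϖ - x) ∈ energyInterior α ϖ := by
  have h0 : x 0 = 0 := by simpa [toAxis] using congrArg (fun v : PhaseSpace => v 0) hax
  have h1 : x 1 = 0 := by simpa [toAxis] using congrArg (fun v : PhaseSpace => v 1) hax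
  have h3 : x 3 = 0 := by simpa [toAxis] using congrArg (fun v : PhaseSpace => v 3) hax
  obtain ⟨hxd, hxH⟩ := hx
  have hr := scaledR_pos hα hxd
  have hc := angParam_pos hα hϖ
  have hmem : x + s • (axisPoint α ϖ - x) ∈ isoDomain :=
    convex_isoDomain.add_smul_sub_mem hxd (axisPoint_mem_isoDomain hα hϖ) ⟨hs.le, hs1⟩
  have hr' := scaledR_pos hα hmem
  refine ⟨hmem, ?_⟩
  have z0 : scaledZ α x = 0 := by simp [scaledZ, h3]
  have e0 : (x + s • (axisPoint α ϖ - x)) 0 = 0 := by simp [axisPoint, h0]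
  have e1 : (x + s • (axisPoint α ϖ - x)) 1 = 0 := by simp [axisPoint, h1]
  have e2 : scaledR α (x + s • (axisPoint α ϖ - x)) =
      scaledR α x + s * (angParam α ϖ - scaledR α x) := by
    rw [← scaledR_axisPoint hα]; simp [scaledR]; ring
  have e3 : scaledZ α (x + s • (axisPoint α ϖ - x)) = 0 := by simp [axisPoint, scaledZ, h3]
  rw [isoHamiltonian_eq hα ϖ hxd, z0, h0, h1, hillFn_zero _ _ hr] at hxH
  rw [isoHamiltonian_eq hα ϖ hmem, e3, e0, e1, hillFn_zero _ _ hr']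
  rw [e2] at hr' ⊢
  set r := scaledR α x
  set c := angParam α ϖ
  have hq : r ^ 2 - 2 * r + c ≤ 0 := by
    have : 0 ≤ -(r ^ 2 - 2 * r + c) / r ^ 2 := by linarith
    have := (div_nonneg_iff.1 this).resolve_right (by
      rintro ⟨-, h⟩
      have : 0 < r ^ 2 := by positivity
      linarith)
    linarith [this.1]
  have hneg : (r + s * (c - r)) ^ 2 - 2 * (r + s * (c - r)) + c < 0 := by
    -- On the axis the body is r² - 2r + c ≤ 0. The point r = c satisfies this strictly because c(c
    -- - 1) < 0, and convexity of the quadratic handles the segment.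
    have e : (r + s * (c - r)) ^ 2 - 2 * (r + s * (c - r)) + c =
      (1 - s) * (r ^ 2 - 2 * r + c) + s * (c * (c - 1)) - s * (1 - s) * (c - r) ^ 2 := by ring
    rw [e]
    have h4 : (1 - s) * (r ^ 2 - 2 * r + c) ≤ 0 :=
      mul_nonpos_of_nonneg_of_nonpos (by linarith) hq
    have h5 : s * (c * (c - 1)) < 0 :=
      mul_neg_of_pos_of_neg hs (mul_neg_of_pos_of_neg hc (by linarith))
    have h6 : 0 ≤ s * (1 - s) * (c - r) ^ 2 :=
      mul_nonneg (mul_nonneg hs.le (by linarith)) (sq_nonneg _)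
    linarith
  have : 0 < -((r + s * (c - r)) ^ 2 - 2 * (r + s * (c - r)) + c) / (r + s * (c - r)) ^ 2 :=
    div_pos (by linarith) (by positivity)
  linarith

lemma toAxis_add_toAxis (x : PhaseSpace) : toAxis (x + toAxis x) = 0 := by
  ext i
  fin_cases i <;> simp [toAxis]

lemma axisPoint_mem (hα : 0 < α) (hϖ : 0 < ϖ) (hc1 : angParam α ϖ < 1) :
    axisPoint α ϖ ∈ energyInterior α ϖ := by
  have hmem := axisPoint_mem_isoDomain hα hϖ
  have hc := angParam_pos hα hϖ
  refine ⟨hmem, ?_⟩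
  have e0 : axisPoint α ϖ 0 = 0 := by simp [axisPoint]
  have e1 : axisPoint α ϖ 1 = 0 := by simp [axisPoint]
  have e3 : scaledZ α (axisPoint α ϖ) = 0 := by simp [axisPoint, scaledZ]
  rw [isoHamiltonian_eq hα ϖ hmem, e3, e0, e1, scaledR_axisPoint hα, hillFn_zero _ _ hc]
  have : 0 < -(angParam α ϖ ^ 2 - 2 * angParam α ϖ + angParam α ϖ) / angParam α ϖ ^ 2 :=
    div_pos (by nlinarith) (by positivity)
  linarith

/-- Moving to the axis {p = 0, z = 0} at fixed r does not raise H, and along the axis every point is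
joined to `axisPoint`. -/
lemma isPreconnected_energyInterior (hα : 0 < α) (hϖ : 0 < ϖ) (hc1 : angParam α ϖ < 1) :
    IsPreconnected (energyInterior α ϖ) := by
  refine isPreconnected_of_forall (axisPoint α ϖ) fun x hx => ?_
  have hmid : x + toAxis x ∈ energyInterior α ϖ := by
    have h1 := isoHamiltonian_toAxis_le (ϖ := ϖ) hα hx.1 zero_le_one le_rfl
    have h2 := toAxis_line_mem x hx.1 1
    rw [one_smul] at h1 h2
    exact ⟨h2, h1.trans_lt hx.2⟩
  refine ⟨segment ℝ x (x + toAxis x) ∪ segment ℝ (x + toAxis x) (axisPoint α ϖ),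
    Set.union_subset ?_ ?_, Or.inr (right_mem_segment ℝ _ _), Or.inl (left_mem_segment ℝ _ _), ?_⟩
  · rw [segment_eq_image']
    rintro _ ⟨s, hs, rfl⟩
    simp only [add_sub_cancel_left]
    exact ⟨toAxis_line_mem x hx.1 s,
      (isoHamiltonian_toAxis_le hα hx.1 hs.1 hs.2).trans_lt hx.2⟩
  · rw [segment_eq_image']
    rintro _ ⟨s, hs, rfl⟩
    rcases hs.1.eq_or_lt with rfl | hs0
    · simpa using hmid
    · exact axis_segment hα hϖ hc1 ⟨hmid.1, hmid.2.le⟩ (toAxis_add_toAxis x) hs0 hs.2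
  · exact IsPreconnected.union (x + toAxis x) (right_mem_segment ℝ _ _) (left_mem_segment ℝ _ _)
      (convex_segment _ _).isPreconnected (convex_segment _ _).isPreconnected

lemma energyBody_subset_closure (hα : 0 < α) (hϖ : 0 < ϖ) (hc1 : angParam α ϖ < 1) :
    energyBody α ϖ ⊆ closure (energyInterior α ϖ) := by
  intro x hx
  have key : ∀ v : PhaseSpace, (∀ s : ℝ, 0 < s → s ≤ 1 → x + s • v ∈ energyInterior α ϖ) →
      x ∈ closure (energyInterior α ϖ) := by
    intro v hv
    have h1 : Tendsto (fun s : ℝ => x + s • v) (𝓝[>] 0) (𝓝 x) := by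
      have h2 : Continuous fun s : ℝ => x + s • v := by fun_prop
      have := h2.tendsto 0
      simp only [zero_smul, add_zero] at this
      exact this.mono_left nhdsWithin_le_nhds
    refine mem_closure_of_tendsto h1 ?_
    filter_upwards [Ioc_mem_nhdsGT (zero_lt_one' ℝ)] with s hs
    exact hv s hs.1 hs.2
  by_cases hax : toAxis x = 0
  · exact key _ fun s hs hs1 => axis_segment hα hϖ hc1 hx hax hs hs1
  · exact key _ fun s hs hs1 => ⟨toAxis_line_mem x hx.1 s,
      (isoHamiltonian_toAxis_lt hα hx.1 hs hs1 hax).trans_le hx.2⟩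

end

/-! ### Compactness of the energy body and convexity of the energy surface -/

section

variable {α ϖ : ℝ}

lemma hillFn_nonneg_of_mem (hα : 0 < α) {x : PhaseSpace} (hx : x ∈ energyBody α ϖ) :
    x 0 ^ 2 + x 1 ^ 2 ≤
      2 * hillFn (betaParam α) (angParam α ϖ) (scaledR α x) (scaledZ α x) := by
  have h := hx.2
  rw [isoHamiltonian_eq hα ϖ hx.1] at h
  linarith

lemma hillFn_bounds {β c r z : ℝ} (hβ0 : 0 < β) (hβ : β < 1) (hc : 0 < c) (hβc : β ^ 2 < c)
    (hr : 0 < r) (hU : 0 ≤ hillFn β c r z) :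
    c / 2 ≤ r ∧ r ≤ 2 ∧ hillFn β c r z ≤ 1 / c ∧ |z| ≤ 2 / (1 - β ^ 2 / c) := by
  have h0 := hillFn_antitone (β := β) (c := c) (z := 0) (z' := z) hβ.le hr
    (by rw [zero_pow two_ne_zero]; positivity)
  rw [hillFn_zero _ _ hr] at h0
  have h1 : 0 ≤ -(r ^ 2 - 2 * r + c) := by
    by_contra! hneg
    have := div_neg_of_neg_of_pos hneg (by positivity : 0 < r ^ 2)
    linarith
  have hd : 0 < 1 - β ^ 2 / c := by rw [sub_pos, div_lt_one hc]; exact hβc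
  refine ⟨by nlinarith, by nlinarith, h0.trans ?_, ?_⟩
  · rw [div_le_div_iff₀ (by positivity) hc]
    nlinarith [sq_nonneg (r - c), mul_nonneg (sq_nonneg r) hc.le]
  · have hR : 0 < √(r ^ 2 + z ^ 2) := Real.sqrt_pos.2 (by positivity)
    have hzR : |z| ≤ √(r ^ 2 + z ^ 2) := by
      rw [← Real.sqrt_sq_eq_abs]
      exact Real.sqrt_le_sqrt (by linarith [sq_nonneg r])
    refine hzR.trans ?_
    have h2 : 1 - β ^ 2 / c ≤ 2 * (1 - β) / √(r ^ 2 + z ^ 2) := by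
      unfold hillFn at hU
      -- Completing the square in 1/r. The condition β² < c, that is β² + ε² < 1, is exactly what
      -- bounds the Hill region in z.
      have e : 1 + c / r ^ 2 - 2 * β / r - (1 - β ^ 2 / c) = c * (1 / r - β / c) ^ 2 := by
        field_simp; ring
      have : 0 ≤ c * (1 / r - β / c) ^ 2 := by positivity
      linarith
    rw [le_div_iff₀ hR] at h2
    rw [le_div_iff₀ hd]
    linarith

lemma isCompact_energyBody (hα : 0 < α) (hϖ : 0 < ϖ) (hβc : betaParam α ^ 2 < angParam α ϖ) :
    IsCompact (energyBody α ϖ) := by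
  have hβ := betaParam_pos hα
  have hβ1 := betaParam_lt_one hα
  have hc := angParam_pos hα hϖ
  have hs : 0 < √(1 + 2 * α) := Real.sqrt_pos.2 (by positivity)
  have hbd : ∀ x ∈ energyBody α ϖ, _ := fun x hx =>
    hillFn_bounds hβ hβ1 hc hβc (scaledR_pos hα hx.1)
      (by linarith [hillFn_nonneg_of_mem hα hx, sq_nonneg (x 0), sq_nonneg (x 1)])
  refine Metric.isCompact_of_isClosed_isBounded ?_ ?_
  -- The domain r > 0 is not closed, so closedness is proved inside the closed half-space r ≥ c/2
  -- (rescaled), which contains the body.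
  · have hclosed : IsClosed {x : PhaseSpace | angParam α ϖ / 2 ≤ scaledR α x} := by
      have : Continuous fun x : PhaseSpace => scaledR α x := by unfold scaledR; fun_prop
      exact isClosed_le continuous_const this
    have hsub : {x : PhaseSpace | angParam α ϖ / 2 ≤ scaledR α x} ⊆ isoDomain := by
      intro x hx
      have h1 : 0 < 2 * betaParam α * x 2 := lt_of_lt_of_le (by positivity) hx
      exact (pos_iff_pos_of_mul_pos h1).1 (by positivity)
    have hcont : ContinuousOn (isoHamiltonian α ϖ)
        {x : PhaseSpace | angParam α ϖ / 2 ≤ scaledR α x} := fun x hx =>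
      (contDiffAt_isoHamiltonian hα ϖ (hsub hx)).continuousAt.continuousWithinAt
    have h2 := hcont.preimage_isClosed_of_isClosed hclosed (isClosed_Iic (a := (-1 : ℝ)))
    have e : energyBody α ϖ = {x : PhaseSpace | angParam α ϖ / 2 ≤ scaledR α x} ∩
        isoHamiltonian α ϖ ⁻¹' Set.Iic (-1) := by
      ext x
      exact ⟨fun hx => ⟨(hbd x hx).1, hx.2⟩, fun hx => ⟨hsub hx.1, hx.2⟩⟩
    rwa [e]
  · rw [isBounded_iff_forall_norm_le]
    refine ⟨√(2 / angParam α ϖ + (2 / (2 * betaParam α)) ^ 2 +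
      (2 / (1 - betaParam α ^ 2 / angParam α ϖ) / (2 * betaParam α * √(1 + 2 * α))) ^ 2),
      fun x hx => ?_⟩
    obtain ⟨-, h2, h3, h4⟩ := hbd x hx
    have h5 := hillFn_nonneg_of_mem hα hx
    have hx2 : 0 < x 2 := hx.1
    rw [EuclideanSpace.norm_eq]
    apply Real.sqrt_le_sqrt
    simp only [Fin.sum_univ_four, Real.norm_eq_abs, sq_abs]
    have h6 : x 0 ^ 2 + x 1 ^ 2 ≤ 2 / angParam α ϖ := by
      have : 2 * (1 / angParam α ϖ) = 2 / angParam α ϖ := by ring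
      linarith
    have h7 : x 2 ^ 2 ≤ (2 / (2 * betaParam α)) ^ 2 := by
      apply pow_le_pow_left₀ hx2.le
      rw [le_div_iff₀ (by positivity), mul_comm]
      exact h2
    have h8 : x 3 ^ 2 ≤ (2 / (1 - betaParam α ^ 2 / angParam α ϖ) /
        (2 * betaParam α * √(1 + 2 * α))) ^ 2 := by
      rw [← sq_abs]
      apply pow_le_pow_left₀ (abs_nonneg _)
      rw [le_div_iff₀ (by positivity)]
      refine le_trans (le_of_eq ?_) h4
      rw [scaledZ, abs_mul _ (x 3), abs_of_pos (by positivity : 0 < 2 * betaParam α * √(1 + 2 * α)),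
        mul_comm]
    linarith

lemma frontier_energyBody (hα : 0 < α) (hϖ : 0 < ϖ) (hβc : betaParam α ^ 2 < angParam α ϖ) :
    frontier (energyBody α ϖ) = energySurface α ϖ := by
  have hcl := (isCompact_energyBody hα hϖ hβc).isClosed
  have hint : interior (energyBody α ϖ) = energyInterior α ϖ := by
    refine Set.Subset.antisymm (fun x hx => ?_)
      (interior_maximal (fun x hx => ⟨hx.1, hx.2.le⟩) (isOpen_energyInterior hα))
    have hxb := interior_subset hx
    refine ⟨hxb.1, lt_of_le_of_ne hxb.2 fun heq => ?_⟩
    -- Pushing p_r away from zero raises H, so a point with H = -1 is not interior; σ is a sign of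
    -- p_r, with either choice allowed at zero.
    obtain ⟨σ, hσ, hσx⟩ : ∃ σ : ℝ, σ ^ 2 = 1 ∧ 0 ≤ σ * x 0 := by
      rcases le_total 0 (x 0) with h | h
      · exact ⟨1, by norm_num, by simpa using h⟩
      · exact ⟨-1, by norm_num, by simpa using h⟩
    have hev : ∀ᶠ t : ℝ in 𝓝[>] 0, x + t • (!₂[σ, 0, 0, 0] : PhaseSpace) ∈ energyBody α ϖ := by
      have h2 : Continuous fun t : ℝ => x + t • (!₂[σ, 0, 0, 0] : PhaseSpace) := by fun_prop
      have := h2.tendsto 0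
      simp only [zero_smul, add_zero] at this
      exact (this.mono_left nhdsWithin_le_nhds).eventually (mem_interior_iff_mem_nhds.1 hx)
    obtain ⟨t, ht, ht0⟩ := (hev.and self_mem_nhdsWithin).exists
    have ht0 : 0 < t := ht0
    have h3 := ht.2
    have e : isoHamiltonian α ϖ (x + t • (!₂[σ, 0, 0, 0] : PhaseSpace)) =
        isoHamiltonian α ϖ x + t * (σ * x 0) + t ^ 2 * σ ^ 2 / 2 := by
      simp [isoHamiltonian]; ring
    rw [e, heq, hσ] at h3
    have := mul_nonneg ht0.le hσx
    have : 0 < t ^ 2 := by positivity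
    linarith
  rw [hcl.frontier_eq, hint]
  ext x
  constructor
  · rintro ⟨h1, h2⟩
    exact ⟨h1.1, le_antisymm h1.2 (not_lt.1 fun h => h2 ⟨h1.1, h⟩)⟩
  · rintro ⟨h1, h2⟩
    exact ⟨⟨h1, h2.le⟩, fun h => h.2.ne h2⟩

lemma energySurfaceConvex_of_convex (hα : 0 < α) (hϖ : 0 < ϖ) (hc1 : angParam α ϖ < 1)
    (hβc : betaParam α ^ 2 < angParam α ϖ) (hconv : Convex ℝ (energyInterior α ϖ)) :
    EnergySurfaceConvex α ϖ := by
  have hcomp := isCompact_energyBody hα hϖ hβc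
  have hsub : energyInterior α ϖ ⊆ energyBody α ϖ := fun x hx => ⟨hx.1, hx.2.le⟩
  have hcl : closure (energyInterior α ϖ) = energyBody α ϖ :=
    Set.Subset.antisymm (closure_minimal hsub hcomp.isClosed)
      (energyBody_subset_closure hα hϖ hc1)
  refine ⟨energyBody α ϖ, hcomp, hcl ▸ hconv.closure, ⟨axisPoint α ϖ, ?_⟩,
    frontier_energyBody hα hϖ hβc⟩
  exact interior_maximal hsub (isOpen_energyInterior hα) (axisPoint_mem hα hϖ hc1)

lemma convex_energyInterior_of_lt (hα : 0 < α) (hϖ : 0 < ϖ) (hc1 : angParam α ϖ < 1)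
    (hb : critBound (betaParam α) ^ 2 < angParam α ϖ) : Convex ℝ (energyInterior α ϖ) :=
  convex_sublevel_of_pos_curvature isOpen_isoDomain convex_isoDomain
    (fun _ hx => contDiffAt_isoHamiltonian hα ϖ hx)
    (isPreconnected_energyInterior hα hϖ hc1)
    (fun _ hx hH _ hv ht => pos_curvature hα hc1 hb hx hH hv ht)

lemma isoHamiltonian_mono {ϖ' : ℝ} (hϖ : 0 < ϖ) (h : ϖ ≤ ϖ') {x : PhaseSpace}
    (hx : x ∈ isoDomain) : isoHamiltonian α ϖ x ≤ isoHamiltonian α ϖ' x := by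
  have hx2 : 0 < x 2 := hx
  unfold isoHamiltonian isoPotential
  gcongr

/-- Two points of the interior remain in it for slightly larger ω > ϖ, where c exceeds the threshold
and the interior is convex. Since H increases with ϖ, the segment lies in the original interior as
well. -/
lemma convex_energyInterior (hα : 0 < α) (hϖ : 0 < ϖ) (hc1 : angParam α ϖ < 1)
    (hb : critBound (betaParam α) ^ 2 ≤ angParam α ϖ) : Convex ℝ (energyInterior α ϖ) := by
  rw [convex_iff_segment_subset]
  intro x hx y hy
  have hβ := betaParam_pos hα
  have hcH : ∀ z : PhaseSpace, Continuous fun ω => isoHamiltonian α ω z := fun z => by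
    unfold isoHamiltonian isoPotential; fun_prop
  have hca : Continuous fun ω => angParam α ω := by unfold angParam; fun_prop
  have hev : ∀ᶠ ω in 𝓝 ϖ, isoHamiltonian α ω x < -1 ∧ isoHamiltonian α ω y < -1 ∧
      angParam α ω < 1 :=
    ((hcH x).continuousAt.eventually (gt_mem_nhds hx.2)).and
      (((hcH y).continuousAt.eventually (gt_mem_nhds hy.2)).and
        (hca.continuousAt.eventually (gt_mem_nhds hc1)))
  obtain ⟨ω, ⟨h1, h2, h3⟩, h4⟩ :=
    ((hev.filter_mono nhdsWithin_le_nhds).and (self_mem_nhdsWithin (s := Set.Ioi ϖ))).exists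
  have h4 : ϖ < ω := h4
  have hω : 0 < ω := hϖ.trans h4
  have hlt : angParam α ϖ < angParam α ω := by unfold angParam; gcongr
  have hconv := convex_energyInterior_of_lt hα hω h3 (hb.trans_lt hlt)
  intro z hz
  have hz' := hconv.segment_subset ⟨hx.1, h1⟩ ⟨hy.1, h2⟩ hz
  exact ⟨hz'.1, (isoHamiltonian_mono hϖ h4.le hz'.1).trans_lt hz'.2⟩

lemma energySurfaceStrictlyConvex_of_lt (hα : 0 < α) (hϖ : 0 < ϖ) (hc1 : angParam α ϖ < 1)
    (hβc : betaParam α ^ 2 < angParam α ϖ)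
    (hb : critBound (betaParam α) ^ 2 < angParam α ϖ) : EnergySurfaceStrictlyConvex α ϖ := by
  refine ⟨energySurfaceConvex_of_convex hα hϖ hc1 hβc (convex_energyInterior_of_lt hα hϖ hc1 hb),
    fun x hx => ⟨fderiv_ne_zero hα hc1 hx.1 hx.2, fun v hv ht => ?_⟩⟩
  exact div_pos (pos_curvature hα hc1 hb hx.1 hx.2 hv ht)
    (norm_pos_iff.2 (fderiv_ne_zero hα hc1 hx.1 hx.2))

/-- Every position in the Hill region lifts to a point of the energy surface at which every
direction of the plane lifts to a tangent vector with the least possible second derivative. -/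
lemma exists_surface_point (hα : 0 < α) {h y : ℝ} (hh0 : 0 < h) (hh1 : h ≤ 1) (hy : 0 < y)
    (hU : 0 < profile (angParam α ϖ) (betaParam α + (1 - betaParam α) * h) y) :
    ∃ x ∈ energySurface α ϖ, ∃ w, h ^ 2 * w ^ 2 = 1 - h ^ 2 ∧
      ∀ u s, ∃ v : PhaseSpace, (u ≠ 0 ∨ s ≠ 0 → v ≠ 0) ∧
        fderiv ℝ (isoHamiltonian α ϖ) x v = 0 ∧
        2 * profile (angParam α ϖ) (betaParam α + (1 - betaParam α) * h) y *
          fderiv ℝ (fderiv ℝ (isoHamiltonian α ϖ)) x v v =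
        firstForm (angParam α ϖ) (betaParam α + (1 - betaParam α) * h) y
          ((1 - betaParam α) * h ^ 3) w u s ^ 2 -
        2 * profile (angParam α ϖ) (betaParam α + (1 - betaParam α) * h) y *
          secondForm (angParam α ϖ) (betaParam α + (1 - betaParam α) * h) y
          ((1 - betaParam α) * h ^ 3) w (2 - 3 * h ^ 2) u s := by
  have hβ := betaParam_pos hα
  have hs : 0 < √(1 + 2 * α) := Real.sqrt_pos.2 (by positivity)
  set c := angParam α ϖ
  set q := betaParam α + (1 - betaParam α) * h
  set P := profile c q y with hP
  have hsP : 0 < √(2 * P) := Real.sqrt_pos.2 (by positivity)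
  have hsP2 : √(2 * P) ^ 2 = 2 * P := Real.sq_sqrt (by positivity)
  obtain ⟨w, hw⟩ : ∃ w, w = √(1 - h ^ 2) / h := ⟨_, rfl⟩
  have hw2 : h ^ 2 * w ^ 2 = 1 - h ^ 2 := by
    rw [hw, div_pow, Real.sq_sqrt (by nlinarith)]
    field_simp
  obtain ⟨x, hx⟩ : ∃ x : PhaseSpace, x = !₂[√(2 * P), 0, 1 / y / (2 * betaParam α),
    w / y / (2 * betaParam α * √(1 + 2 * α))] := ⟨_, rfl⟩
  have hx0 : x 0 = √(2 * P) := by simp [hx]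
  have hx1 : x 1 = 0 := by simp [hx]
  have hxR : scaledR α x = 1 / y := by
    simp [hx, scaledR]
    field_simp
  have hxZ : scaledZ α x = w / y := by
    simp [hx, scaledZ]
    field_simp
  have hxd : x ∈ isoDomain := by
    have : 0 < 1 / y / (2 * betaParam α) := by positivity
    simpa [isoDomain, hx] using this
  have hr : 0 < 1 / y := by positivity
  have hratio : 1 / y / √((1 / y) ^ 2 + (w / y) ^ 2) = h := by
    have e : (1 / y) ^ 2 + (w / y) ^ 2 = (1 / (h * y)) ^ 2 := by
      field_simp
      linarith
    rw [e, Real.sqrt_sq (by positivity)]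
    field_simp
  have hwr : w / y / (1 / y) = w := by field_simp
  have hyy : 1 / (1 / y) = y := by field_simp
  refine ⟨x, ⟨hxd, ?_⟩, w, hw2, fun u s => ?_⟩
  · rw [isoHamiltonian_eq hα ϖ hxd, hxR, hxZ, hillFn_eq_profile _ _ hr, hratio, hyy, hx0, hx1, hsP2]
    ring
  · obtain ⟨v, hv⟩ : ∃ v : PhaseSpace, v = !₂[firstForm c q y ((1 - betaParam α) * h ^ 3) w u s /
      √(2 * P), 0, u / (2 * betaParam α), (s + w * u) / (2 * betaParam α * √(1 + 2 * α))] := ⟨_, rfl⟩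
    have hv0 : v 0 = firstForm c q y ((1 - betaParam α) * h ^ 3) w u s / √(2 * P) := by simp [hv]
    have hv1 : v 1 = 0 := by simp [hv]
    have hvR : scaledR α v = u := by
      simp [hv, scaledR]
      field_simp
    have hvZ : scaledZ α v = s + w * u := by
      simp [hv, scaledZ]
      field_simp
    refine ⟨v, ?_, ?_, ?_⟩
    · rintro hus rfl
      have h1 : u = 0 := by rw [← hvR]; simp [scaledR]
      have h2 : s + w * u = 0 := by rw [← hvZ]; simp [scaledZ]
      rw [h1, mul_zero, add_zero] at h2
      exact hus.elim (fun h => h h1) (fun h => h h2)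
    · rw [fderiv_isoHamiltonian hα ϖ hxd, hxR, hxZ, hillD_eq_firstForm _ _ hr, hratio, hyy, hwr,
        hvR, hvZ, hx0, hx1, hv0, add_sub_cancel_right, mul_div_cancel₀ _ hsP.ne']
      ring
    · rw [fderiv_fderiv_isoHamiltonian hα ϖ hxd, hxR, hxZ, hillDD_eq_secondForm _ _ hr, hratio, hyy,
        hwr, hvR, hvZ, hv0, hv1, add_sub_cancel_right, div_pow, hsP2]
      field_simp
      ring

/-- The degenerate direction of the planar form lifts to a nonzero tangent vector on which D²H is
not positive. -/
lemma not_strictlyConvex_of_le (hα : 0 < α) (hϖ : 0 < ϖ)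
    (hb : angParam α ϖ ≤ critBound (betaParam α) ^ 2) : ¬ EnergySurfaceStrictlyConvex α ϖ := by
  rintro ⟨-, hpos⟩
  have hβ1 := betaParam_lt_one hα
  obtain ⟨h, y, hh0, hh1, hy, hU, hD, -⟩ :=
    exists_degenerate_point (betaParam_pos hα).le hβ1 (angParam_pos hα hϖ) hb
  obtain ⟨x, hx, w, hw, hdir⟩ := exists_surface_point hα hh0 hh1 hy hU
  have hμ : (1 - betaParam α) * h ^ 3 * w ^ 2 = (1 - betaParam α) * h * (1 - h ^ 2) := by
    linear_combination (1 - betaParam α) * h * hw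
  obtain ⟨u, s, hus, hle⟩ := exists_degenerate_direction (w := w) hy
    (mul_pos (by linarith) (by positivity) : 0 < (1 - betaParam α) * h ^ 3) hU (by rwa [hμ])
  obtain ⟨v, hv, ht, he⟩ := hdir u s
  have h1 := (hpos x hx).2 v (hv hus) ht
  have h2 : fderiv ℝ (fderiv ℝ (isoHamiltonian α ϖ)) x v v ≤ 0 :=
    nonpos_of_mul_nonpos_right (by rw [he]; linarith)
      (by positivity : 0 < 2 * profile (angParam α ϖ) (betaParam α + (1 - betaParam α) * h) y)
  exact absurd h1 (not_lt.2 (div_nonpos_of_nonpos_of_nonneg h2 (norm_nonneg _)))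

/-- Every point of the energy interior lies between two points of the energy surface. -/
lemma energyInterior_subset {K : Set PhaseSpace} (hK : Convex ℝ K) (hS : energySurface α ϖ ⊆ K) :
    energyInterior α ϖ ⊆ K := by
  intro x hx
  set a := √(x 0 ^ 2 + 2 * (-1 - isoHamiltonian α ϖ x)) with ha
  have hd : 0 < -1 - isoHamiltonian α ϖ x := by linarith [hx.2]
  have ha0 : 0 < a := Real.sqrt_pos.2 (by positivity)
  have ha2 : a ^ 2 = x 0 ^ 2 + 2 * (-1 - isoHamiltonian α ϖ x) := Real.sq_sqrt (by positivity)
  have hxa := abs_le_of_sq_le_sq' (by linarith : x 0 ^ 2 ≤ a ^ 2) ha0.le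
  have hmem : ∀ b : ℝ, b ^ 2 = a ^ 2 → (!₂[b, x 1, x 2, x 3] : PhaseSpace) ∈ K := by
    intro b hb
    refine hS ⟨by simpa [isoDomain] using (show 0 < x 2 from hx.1), ?_⟩
    have : isoHamiltonian α ϖ !₂[b, x 1, x 2, x 3] =
        isoHamiltonian α ϖ x + (b ^ 2 - x 0 ^ 2) / 2 := by
      simp [isoHamiltonian]; ring
    rw [this, hb, ha2]; ring
  have h1 := hK (hmem a rfl) (hmem (-a) (by ring)) (a := (a + x 0) / (2 * a))
    (b := (a - x 0) / (2 * a)) (div_nonneg (by linarith) (by linarith))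
    (div_nonneg (by linarith) (by linarith)) (by field_simp; ring)
  convert h1 using 1
  ext i
  fin_cases i <;> simp <;> field_simp <;> ring

/-- Any convex K bounded by the surface contains the open sublevel set, so D²H would be nonnegative
on every tangent space; below the threshold for c some tangent vector has D²H < 0. -/
lemma not_convex_of_lt (hα : 0 < α) (hϖ : 0 < ϖ)
    (hb : angParam α ϖ < critBound (betaParam α) ^ 2) : ¬ EnergySurfaceConvex α ϖ := by
  rintro ⟨K, hKc, hK, -, hfr⟩
  have hβ1 := betaParam_lt_one hα
  obtain ⟨h, y, hh0, hh1, hy, hU, -, hD⟩ :=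
    exists_degenerate_point (betaParam_pos hα).le hβ1 (angParam_pos hα hϖ) hb.le
  obtain ⟨x, hx, w, hw, hdir⟩ := exists_surface_point hα hh0 hh1 hy hU
  have hμ : (1 - betaParam α) * h ^ 3 * w ^ 2 = (1 - betaParam α) * h * (1 - h ^ 2) := by
    linear_combination (1 - betaParam α) * h * hw
  obtain ⟨u, s, hlt⟩ := exists_negative_direction (w := w) hy
    (mul_pos (by linarith) (by positivity) : 0 < (1 - betaParam α) * h ^ 3) hU
    (by rw [hμ]; exact hD hb)
  obtain ⟨v, -, ht, he⟩ := hdir u s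
  have hS : energySurface α ϖ ⊆ K := by
    rw [← hfr]; exact hKc.isClosed.frontier_subset
  have hW : {z | z ∈ isoDomain ∧ isoHamiltonian α ϖ z < isoHamiltonian α ϖ x} =
      energyInterior α ϖ := by rw [hx.2]; rfl
  have h1 := nonneg_of_mem_frontier hK (hfr ▸ hx) (contDiffAt_isoHamiltonian hα ϖ hx.1)
    (isOpen_isoDomain.mem_nhds hx.1) (by rw [hW]; exact isOpen_energyInterior hα)
    (by rw [hW]; exact energyInterior_subset hK hS) ht
  have h2 := mul_nonneg hU.le h1
  linarith

end

theorem theorem2p11 :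
    ∃ εconv : ℝ → ℝ,
      Set.MapsTo εconv (Set.Icc 0 1) (Set.Icc 0 1) ∧
      StrictAntiOn εconv (Set.Icc 0 1) ∧
      ConcaveOn ℝ (Set.Icc 0 1) εconv ∧
      εconv 0 = (7 + Real.sqrt 17) / 16 ∧
      εconv 1 = 0 ∧
      (∀ β ∈ Set.Ioo (0 : ℝ) 1, (β, εconv β) ∈ paramDomain) ∧
      ∀ α ϖ : ℝ, 0 < α → 0 < ϖ → (betaParam α, epsParam α ϖ) ∈ paramDomain →
        (epsParam α ϖ < εconv (betaParam α) ↔ EnergySurfaceStrictlyConvex α ϖ) ∧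
        (epsParam α ϖ = εconv (betaParam α) ↔
          (EnergySurfaceConvex α ϖ ∧ ¬ EnergySurfaceStrictlyConvex α ϖ)) ∧
        (εconv (betaParam α) < epsParam α ϖ ↔ ¬ EnergySurfaceConvex α ϖ) := by
  refine ⟨epsConv, fun β _ => epsConv_mem β, strictAntiOn_epsConv, concaveOn_epsConv, epsConv_zero,
    epsConv_one, fun β hβ => epsConv_mem_paramDomain hβ.1 hβ.2, fun α ϖ hα hϖ hD => ?_⟩
  obtain ⟨-, hlt, -, heps⟩ := hD
  simp only at hlt heps
  have hpos : 0 < 1 - angParam α ϖ := Real.sqrt_pos.1 heps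
  have he2 : epsParam α ϖ ^ 2 = 1 - angParam α ϖ := Real.sq_sqrt hpos.le
  have hc1 : angParam α ϖ < 1 := by linarith
  have hβc : betaParam α ^ 2 < angParam α ϖ := by linarith
  have hSC : epsParam α ϖ < epsConv (betaParam α) → EnergySurfaceStrictlyConvex α ϖ := fun h => by
    have := (Real.sqrt_lt_sqrt_iff hpos.le).1 h
    exact energySurfaceStrictlyConvex_of_lt hα hϖ hc1 hβc (by linarith)
  have hC : epsParam α ϖ = epsConv (betaParam α) →
      EnergySurfaceConvex α ϖ ∧ ¬ EnergySurfaceStrictlyConvex α ϖ := fun h => by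
    have hcb : angParam α ϖ = critBound (betaParam α) ^ 2 := by
      have h1 : epsConv (betaParam α) ^ 2 = 1 - critBound (betaParam α) ^ 2 := by
        apply Real.sq_sqrt
        have := critBound_lt_one (betaParam_lt_one hα)
        nlinarith [critBound_pos (betaParam α)]
      rw [← h, he2] at h1
      linarith
    exact ⟨energySurfaceConvex_of_convex hα hϖ hc1 hβc
      (convex_energyInterior hα hϖ hc1 hcb.ge), not_strictlyConvex_of_le hα hϖ hcb.le⟩
  have hN : epsConv (betaParam α) < epsParam α ϖ → ¬ EnergySurfaceConvex α ϖ := fun h => by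
    have := (Real.sqrt_lt_sqrt_iff_of_pos hpos).1 h
    exact not_convex_of_lt hα hϖ (by linarith)
  have hSC' : EnergySurfaceStrictlyConvex α ϖ → EnergySurfaceConvex α ϖ := fun h => h.1
  -- The three convexity alternatives exclude each other, so the forward implications already give
  -- all the equivalences.
  rcases lt_trichotomy (epsParam α ϖ) (epsConv (betaParam α)) with h | h | h
  · have h1 := hSC h
    have h2 := hSC' h1
    exact ⟨iff_of_true h h1, iff_of_false h.ne fun h3 => h3.2 h1,
      iff_of_false h.not_gt fun h3 => h3 h2⟩
  · have h1 := hC h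
    exact ⟨iff_of_false h.not_lt h1.2, iff_of_true h h1, iff_of_false h.not_gt fun h3 => h3 h1.1⟩
  · have h1 := hN h
    exact ⟨iff_of_false h.not_gt fun h3 => h1 (hSC' h3), iff_of_false h.ne' fun h3 => h1 h3.1,
      iff_of_true h h1⟩

end
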